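/- Let $\varepsilon,\beta\in(0,1)$ with $\varepsilon+\beta<1$ and let $c>0$. There is a constant $C>0$, depending only on $\varepsilon,\beta,c$, such that the following holds for every $n\ge 1$ and all real numbers $p_{ij}$ ($1\le i<j\le n$), which may depend on $n$, with $$\frac{c\ln n}{n^{\beta}}\;\le\; p_{ij}\;\le\; 1-\frac{c\ln n}{n^{\beta}}\qquad(1\le i<j\le n),$$ that is, $\min_{1\le i<j\le n}\min\{p_{ij},1-p_{ij}\}\in\left[\frac{c\ln n}{n^{\beta}},\frac12\right]$ when $n\ge2$. There is a random simple graph on the vertices $1,\dots,n$ in which the pairs $i<j$ are linked independently of each other, the pair $i<j$ with probability $p_{ij}$; and for every such random graph its ($0$–$1$, zero-diagonal) adjacency matrix $A_n$ satisfies $$\Pr\{\operatorname{rank}(A_n)<n\}\;\le\; C\,n^{-(1-\varepsilon-\beta)/4},$$ the rank being taken over $\mathbb{R}$. -/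

import Mathlib

open MeasureTheory ProbabilityTheory

/-- The 0-1 adjacency matrix of a graph on `{0, …, n-1}`, with real entries. -/
noncomputable def realAdjMatrix {n : ℕ} (G : SimpleGraph (Fin n)) :
    Matrix (Fin n) (Fin n) ℝ :=
  letI : DecidableRel G.Adj := Classical.decRel _
  G.adjMatrix ℝ

/-- `G` is a random simple graph on `n` vertices, defined on `(Ω, μ)`, in which the pairs
`i < j` are linked independently of each other, the pair `i < j` with probability `p i j`. -/
structure IsIndepEdgeRandomGraph {n : ℕ} (p : Fin n → Fin n → ℝ) {Ω : Type*}
    [MeasurableSpace Ω] (μ : Measure Ω) (G : Ω → SimpleGraph (Fin n)) : Prop where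
  measurableSet_adj : ∀ i j : Fin n, i < j → MeasurableSet {ω | (G ω).Adj i j}
  prob_adj : ∀ i j : Fin n, i < j → μ.real {ω | (G ω).Adj i j} = p i j
  indep_adj : iIndepSet
    (fun e : {e : Fin n × Fin n // e.1 < e.2} => {ω | (G ω).Adj e.1.1 e.1.2}) μ

/-!
Write `q` for the lower bound `c * log n / n ^ β` of the edge probabilities and of their
complements. The whole argument takes place under finite products of Bernoulli laws, and all the
conditioning in it is done by resampling coordinates (`prodExp_extend`, `prodExp_piecewise`).

*Concentration.* Let `S` be a sum of independent Bernoulli variables with parameters in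
`[q, 1 - q]`, `m` of them with nonzero coefficients. Exposing the summands one at a time, and
using that a nonempty finite set of reals differs from its nonzero translates, shows that
`P (S ∈ T) ≤ walkBound q m T.card`, where `walkBound q m k` is the probability that a lazy random
walk started at `k` survives `m` steps without hitting `0` (`prodPr_sum_eq_le`). Two moment
identities for this walk give `walkBound q m 1 ≤ 2 / √(q m)` (`walkBound_one_le`). By decoupling, a
quadratic form with sufficiently many dense rows takes the value `0` with probability of order
`(q m) ^ (-1/4)` (`sq_prodPr_quadratic_le`).

*No sparse near-null vectors.* Let `h` be about `n ^ (1 - ε / 5)`. Except with tiny probability,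
every nonzero vector orthogonal to all but two rows of the adjacency matrix has at least `4 * h`
nonzero coordinates (`prodPr_sparseNearNull_le`). If the support of an exception is `S`, then some
`S.card` rows determine a null vector with support `S`, to which all the remaining rows have to be
orthogonal; those rows are independent of it, and a union bound over the choices is affordable.

*Exposing one vertex.* Suppose that there are no sparse near-null vectors, and expose the row of
a vertex `i` last. If the matrix has a null vector `v` with `v i ≠ 0`, then either the minor without
`i` is singular and the exposed row is orthogonal to a dense null vector of it, or that minor is
invertible and the exposed row annihilates the quadratic form of its inverse, whose rows are
near-null vectors and hence dense. Either has probability of order `(q h) ^ (-1/4)`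
(`prodPr_exists_null_extend_le`).

*Averaging.* A null vector of the full matrix has at least `4 * h` nonzero coordinates, so
the probability of singularity is at most `n / (4 * h)` times the bound for a single vertex
(`prodPr_singular_le`). The loss is of order `n ^ (ε / 5)`, and `h` is smaller than `n` by the same
factor inside the fourth root; together these account for the `ε` in the rate.
-/

/-! ### Products of Bernoulli laws -/

/-- The expectation of `f` under the product of Bernoulli laws, the coordinate `i` being `true`
with probability `p i`. -/
noncomputable def prodExp {ι : Type*} [Fintype ι] [DecidableEq ι] (p : ι → ℝ)
    (f : (ι → Bool) → ℝ) : ℝ :=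
  ∑ x : ι → Bool, (∏ i, if x i then p i else 1 - p i) * f x

/-- The probability of `B` under the product of Bernoulli laws with parameters `p`. -/
noncomputable def prodPr {ι : Type*} [Fintype ι] [DecidableEq ι] (p : ι → ℝ)
    (B : Set (ι → Bool)) : ℝ :=
  prodExp p (B.indicator 1)

section ProductBernoulli

variable {ι α : Type*} [Fintype ι] [DecidableEq ι] [Fintype α] [DecidableEq α] {p : ι → ℝ}

lemma prodExp_const (p : ι → ℝ) (a : ℝ) : prodExp p (fun _ => a) = a := by
  have h := Finset.prod_univ_sum (fun _ : ι => (Finset.univ : Finset Bool))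
    (fun i b => if b then p i else 1 - p i)
  simp only [Fintype.piFinset_univ] at h
  rw [prodExp, ← Finset.sum_mul, ← h]
  simp

lemma prodExp_add (p : ι → ℝ) (f g : (ι → Bool) → ℝ) :
    prodExp p (fun x => f x + g x) = prodExp p f + prodExp p g := by
  simp only [prodExp, mul_add, Finset.sum_add_distrib]

lemma prodExp_mul_left (p : ι → ℝ) (a : ℝ) (f : (ι → Bool) → ℝ) :
    prodExp p (fun x => a * f x) = a * prodExp p f := by
  simp only [prodExp, Finset.mul_sum]
  exact Finset.sum_congr rfl fun x _ => by ring

lemma prodExp_sum {κ : Type*} (p : ι → ℝ) (s : Finset κ) (f : κ → (ι → Bool) → ℝ) :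
    prodExp p (fun x => ∑ k ∈ s, f k x) = ∑ k ∈ s, prodExp p (f k) := by
  simp only [prodExp, Finset.mul_sum]
  exact Finset.sum_comm

lemma prodExp_comm {p' : α → ℝ} (f : (ι → Bool) → (α → Bool) → ℝ) :
    prodExp p (fun x => prodExp p' (f x)) = prodExp p' (fun y => prodExp p fun x => f x y) := by
  simp only [prodExp, Finset.mul_sum]
  rw [Finset.sum_comm]
  exact Finset.sum_congr rfl fun x _ => Finset.sum_congr rfl fun y _ => by ring

lemma prodWeight_nonneg {ι : Type*} [Fintype ι] {p : ι → ℝ} (h0 : ∀ i, 0 ≤ p i)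
    (h1 : ∀ i, p i ≤ 1) (x : ι → Bool) :
    0 ≤ ∏ i, if x i then p i else 1 - p i :=
  Finset.prod_nonneg fun i _ => by
    split_ifs
    · exact h0 i
    · linarith [h1 i]

lemma prodExp_mono (h0 : ∀ i, 0 ≤ p i) (h1 : ∀ i, p i ≤ 1) {f g : (ι → Bool) → ℝ}
    (hfg : ∀ x, f x ≤ g x) : prodExp p f ≤ prodExp p g :=
  Finset.sum_le_sum fun x _ => mul_le_mul_of_nonneg_left (hfg x) (prodWeight_nonneg h0 h1 x)

lemma prodExp_le_of_forall_le (h0 : ∀ i, 0 ≤ p i) (h1 : ∀ i, p i ≤ 1) {f : (ι → Bool) → ℝ} {a : ℝ}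
    (hf : ∀ x, f x ≤ a) : prodExp p f ≤ a :=
  (prodExp_mono h0 h1 hf).trans_eq (prodExp_const p a)

lemma sq_prodExp_le (h0 : ∀ i, 0 ≤ p i) (h1 : ∀ i, p i ≤ 1) (f : (ι → Bool) → ℝ) :
    prodExp p f ^ 2 ≤ prodExp p fun x => f x ^ 2 := by
  set m := prodExp p f with hm
  have h : (0 : ℝ) ≤ prodExp p fun x => (f x ^ 2 + (-2 * m) * f x) + m ^ 2 := by
    rw [← prodExp_const p 0]
    exact prodExp_mono h0 h1 fun x => by nlinarith [sq_nonneg (f x - m)]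
  rw [prodExp_add, prodExp_add, prodExp_mul_left, prodExp_const, ← hm] at h
  nlinarith

lemma prodPr_mono (h0 : ∀ i, 0 ≤ p i) (h1 : ∀ i, p i ≤ 1) {B C : Set (ι → Bool)} (h : B ⊆ C) :
    prodPr p B ≤ prodPr p C :=
  prodExp_mono h0 h1 fun x => Set.indicator_le_indicator_of_subset h (fun _ => zero_le_one) x

lemma prodPr_le_one (h0 : ∀ i, 0 ≤ p i) (h1 : ∀ i, p i ≤ 1) (B : Set (ι → Bool)) :
    prodPr p B ≤ 1 :=
  prodExp_le_of_forall_le h0 h1 fun x => Set.indicator_le_self' (fun _ _ => zero_le_one) x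

lemma prodPr_empty (p : ι → ℝ) : prodPr p (∅ : Set (ι → Bool)) = 0 := by
  simp [prodPr, prodExp]

lemma prodPr_biUnion_le {κ : Type*} (h0 : ∀ i, 0 ≤ p i) (h1 : ∀ i, p i ≤ 1) (s : Finset κ)
    (B : κ → Set (ι → Bool)) : prodPr p (⋃ k ∈ s, B k) ≤ ∑ k ∈ s, prodPr p (B k) := by
  simp only [prodPr]
  rw [← prodExp_sum]
  refine prodExp_mono h0 h1 fun x => ?_
  have hnn : ∀ k ∈ s, (0 : ℝ) ≤ (B k).indicator 1 x :=
    fun k _ => Set.indicator_nonneg (fun _ _ => zero_le_one) x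
  by_cases hx : x ∈ ⋃ k ∈ s, B k
  · rw [Set.indicator_of_mem hx]
    simp only [Set.mem_iUnion] at hx
    obtain ⟨k, hk, hxk⟩ := hx
    calc (1 : (ι → Bool) → ℝ) x = (B k).indicator 1 x := (Set.indicator_of_mem hxk _).symm
      _ ≤ _ := Finset.single_le_sum hnn hk
  · rw [Set.indicator_of_notMem hx]
    exact Finset.sum_nonneg hnn

/-- Resampling the coordinates in the range of `φ` from an independent copy does not change the
law. The map `(x, y) ↦ (extend φ y x, x ∘ φ)` is an involution that preserves the joint weight. -/
lemma prodExp_extend (p : ι → ℝ) {φ : α → ι} (hφ : φ.Injective) (f : (ι → Bool) → ℝ) :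
    prodExp p (fun x => prodExp (p ∘ φ) fun y => f (Function.extend φ y x)) = prodExp p f := by
  have key : prodExp p f = prodExp p (fun x => prodExp (p ∘ φ) fun _ => f x) := by
    simp only [prodExp_const]
  rw [key]
  simp only [prodExp, Finset.mul_sum]
  rw [← Finset.sum_product', ← Finset.sum_product']
  let T : (ι → Bool) × (α → Bool) → (ι → Bool) × (α → Bool) :=
    fun z => (Function.extend φ z.2 z.1, z.1 ∘ φ)
  have hT : ∀ z, T (T z) = z := by
    rintro ⟨x, y⟩
    simp only [T, Prod.mk.injEq]
    refine ⟨funext fun i => ?_, funext fun a => hφ.extend_apply _ _ _⟩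
    by_cases hi : ∃ a, φ a = i
    · obtain ⟨a, rfl⟩ := hi
      rw [hφ.extend_apply]; rfl
    · rw [Function.extend_apply' _ _ _ hi, Function.extend_apply' _ _ _ hi]
  refine Finset.sum_bij' (fun z _ => T z) (fun z _ => T z) (by simp) (by simp)
    (fun z _ => hT z) (fun z _ => hT z) ?_
  rintro ⟨x, y⟩ -
  simp only [T, ← mul_assoc]
  congr 1
  have hsplit : ∀ x : ι → Bool, (∏ i, if x i then p i else 1 - p i) =
      (∏ a, if x (φ a) then p (φ a) else 1 - p (φ a)) *
        ∏ i ∈ (Finset.univ.image φ)ᶜ, if x i then p i else 1 - p i := fun x => by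
    rw [← Finset.prod_mul_prod_compl (Finset.univ.image φ),
      Finset.prod_image fun a _ b _ h => hφ h]
  rw [hsplit x, hsplit (Function.extend φ y x)]
  simp only [hφ.extend_apply, Function.comp_apply]
  have : ∏ i ∈ (Finset.univ.image φ)ᶜ, (if Function.extend φ y x i then p i else 1 - p i) =
      ∏ i ∈ (Finset.univ.image φ)ᶜ, (if x i then p i else 1 - p i) :=
    Finset.prod_congr rfl fun i hi => by
      rw [Function.extend_apply' _ _ _ (by simpa using hi)]
  rw [this]
  ring

/-- Resampling the coordinates in `U` from an independent copy of the whole vector does not change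
the law. -/
lemma prodExp_piecewise (p : ι → ℝ) (U : Finset ι) (f : (ι → Bool) → ℝ) :
    prodExp p (fun x => prodExp p fun z => f (U.piecewise z x)) = prodExp p f := by
  have key : prodExp p f = prodExp p (fun x => prodExp p fun _ => f x) := by
    simp only [prodExp_const]
  rw [key]
  simp only [prodExp, Finset.mul_sum]
  rw [← Finset.sum_product', ← Finset.sum_product']
  let T : (ι → Bool) × (ι → Bool) → (ι → Bool) × (ι → Bool) :=
    fun z => (U.piecewise z.2 z.1, U.piecewise z.1 z.2)
  have hT : ∀ z, T (T z) = z := by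
    rintro ⟨x, y⟩
    simp only [T, Prod.mk.injEq]
    constructor <;>
    · funext i
      by_cases hi : i ∈ U <;> simp [hi]
  refine Finset.sum_bij' (fun z _ => T z) (fun z _ => T z) (by simp) (by simp)
    (fun z _ => hT z) (fun z _ => hT z) ?_
  rintro ⟨x, y⟩ -
  simp only [T, ← mul_assoc, ← Finset.prod_mul_distrib]
  congr 1
  refine Finset.prod_congr rfl fun i _ => ?_
  by_cases hi : i ∈ U
  · simp [hi, mul_comm]
  · simp [hi]

lemma prodPr_extend (p : ι → ℝ) {φ : α → ι} (hφ : φ.Injective) (B : Set (ι → Bool)) :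
    prodExp p (fun x => prodPr (p ∘ φ) {y | Function.extend φ y x ∈ B}) = prodPr p B :=
  prodExp_extend p hφ (B.indicator 1)

/-- If `F` does not depend on the coordinates in the range of `φ`, and given `F` the
event `B` has conditional probability at most `r`, then `P (F ∩ B) ≤ r * P F`. -/
lemma prodPr_inter_le (h0 : ∀ i, 0 ≤ p i) (h1 : ∀ i, p i ≤ 1) {φ : α → ι} (hφ : φ.Injective)
    {F B : Set (ι → Bool)} {r : ℝ} (hF : ∀ x y, Function.extend φ y x ∈ F → x ∈ F)
    (hB : ∀ x ∈ F, prodPr (p ∘ φ) {y | Function.extend φ y x ∈ B} ≤ r) :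
    prodPr p (F ∩ B) ≤ r * prodPr p F := by
  rw [← prodPr_extend p hφ, prodPr, ← prodExp_mul_left]
  refine prodExp_mono h0 h1 fun x => ?_
  by_cases hx : x ∈ F
  · rw [Set.indicator_of_mem hx, Pi.one_apply, mul_one]
    exact (prodPr_mono (fun _ => h0 _) (fun _ => h1 _) fun y hy => hy.2).trans (hB x hx)
  · rw [Set.indicator_of_notMem hx, mul_zero]
    refine le_of_eq ?_
    rw [← prodPr_empty (p ∘ φ)]
    congr 1
    exact Set.eq_empty_of_forall_notMem fun y hy => hx (hF x y hy.1)

/-- Conditioning on a single coordinate. -/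
lemma prodPr_update (p : ι → ℝ) (a : ι) (B : Set (ι → Bool)) :
    prodPr p B = (1 - p a) * prodPr p {x | Function.update x a false ∈ B} +
      p a * prodPr p {x | Function.update x a true ∈ B} := by
  have hφ : Function.Injective (fun _ : Unit => a) := fun _ _ _ => rfl
  have hext : ∀ (x : ι → Bool) (y : Unit → Bool),
      Function.extend (fun _ : Unit => a) y x = Function.update x a (y ()) := fun x y => by
    funext i
    by_cases hi : i = a
    · subst hi
      rw [Function.update_self]
      exact hφ.extend_apply y x ()
    · rw [Function.update_of_ne hi, Function.extend_apply' _ _ _ (fun ⟨_, h⟩ => hi h.symm)]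
  rw [← prodPr_extend p hφ, prodPr, prodPr, ← prodExp_mul_left, ← prodExp_mul_left,
    ← prodExp_add]
  congr 1
  funext x
  simp only [hext, prodPr]
  rw [prodExp, ← (Equiv.funUnique Unit Bool).symm.sum_comp]
  simp [Set.indicator, add_comm]
  rfl

end ProductBernoulli

/-! ### The Littlewood–Offord bound -/

/-- A bound for the probability that a sum of `m` independent nonzero multiples of
Bernoulli variables, with parameters in `[q, 1 - q]`, lies in a given set of `k` reals. It is the
probability that a lazy random walk on `ℤ` started at `k`, with steps `±1` of probability `q` each,
has not reached `0` by time `m`. -/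
noncomputable def walkBound (q : ℝ) : ℕ → ℕ → ℝ
  | 0, 0 => 0
  | 0, _ + 1 => 1
  | _ + 1, 0 => 0
  | m + 1, k + 1 => (1 - 2 * q) * walkBound q m (k + 1) +
      q * (walkBound q m (k + 2) + walkBound q m k)

section WalkBound

variable {q : ℝ}

lemma walkBound_zero_right (q : ℝ) (m : ℕ) : walkBound q m 0 = 0 := by
  cases m <;> rfl

lemma walkBound_zero_succ (q : ℝ) (k : ℕ) : walkBound q 0 (k + 1) = 1 := rfl

lemma walkBound_succ_succ (q : ℝ) (m k : ℕ) :
    walkBound q (m + 1) (k + 1) = (1 - 2 * q) * walkBound q m (k + 1) +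
      q * (walkBound q m (k + 2) + walkBound q m k) := rfl

lemma walkBound_eq_one (q : ℝ) {m k : ℕ} (h : m < k) : walkBound q m k = 1 := by
  induction m generalizing k with
  | zero => obtain ⟨k, rfl⟩ := Nat.exists_eq_succ_of_ne_zero h.ne'; rfl
  | succ m ih =>
    obtain ⟨k, rfl⟩ := Nat.exists_eq_succ_of_ne_zero (Nat.ne_of_gt (Nat.zero_lt_of_lt h))
    rw [Nat.succ_eq_add_one, walkBound_succ_succ, ih (by omega), ih (by omega), ih (by omega)]
    ring

lemma walkBound_nonneg (h0 : 0 ≤ q) (h1 : q ≤ 1 / 2) (m k : ℕ) : 0 ≤ walkBound q m k := by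
  induction m generalizing k with
  | zero => cases k <;> simp [walkBound]
  | succ m ih =>
    cases k with
    | zero => rw [walkBound_zero_right]
    | succ k =>
      rw [walkBound_succ_succ]
      have := ih k; have := ih (k + 1); have := ih (k + 2)
      have : 0 ≤ 1 - 2 * q := by linarith
      positivity

lemma walkBound_le_one (h0 : 0 ≤ q) (h1 : q ≤ 1 / 2) (m k : ℕ) : walkBound q m k ≤ 1 := by
  induction m generalizing k with
  | zero => cases k <;> simp [walkBound]
  | succ m ih =>
    cases k with
    | zero => rw [walkBound_zero_right]; exact zero_le_one
    | succ k =>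
      rw [walkBound_succ_succ]
      have h2 : 0 ≤ 1 - 2 * q := by linarith
      nlinarith [mul_le_mul_of_nonneg_left (ih (k + 1)) h2, mul_le_mul_of_nonneg_left (ih k) h0,
        mul_le_mul_of_nonneg_left (ih (k + 2)) h0]

lemma walkBound_concave (h0 : 0 ≤ q) (h1 : q ≤ 1 / 2) (m k : ℕ) :
    walkBound q m (k + 2) + walkBound q m k ≤ 2 * walkBound q m (k + 1) := by
  induction m generalizing k with
  | zero => cases k <;> norm_num [walkBound]
  | succ m ih =>
    have h2 : 0 ≤ 1 - 2 * q := by linarith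
    cases k with
    | zero =>
      have e0 := walkBound_zero_right q m
      have e1 := walkBound_zero_right q (m + 1)
      have a := mul_le_mul_of_nonneg_left (ih 0) h2
      have b := mul_le_mul_of_nonneg_left (ih 1) h0
      rw [walkBound_succ_succ, walkBound_succ_succ, e1]
      norm_num at a b ⊢
      rw [e0] at a ⊢
      nlinarith
    | succ k =>
      have a := mul_le_mul_of_nonneg_left (ih (k + 1)) h2
      have b := mul_le_mul_of_nonneg_left (ih k) h0
      have d := mul_le_mul_of_nonneg_left (ih (k + 2)) h0
      rw [walkBound_succ_succ, walkBound_succ_succ, walkBound_succ_succ]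
      simp only [Nat.add_assoc, Nat.reduceAdd] at a b d ⊢
      nlinarith

lemma walkBound_succ_le (h0 : 0 ≤ q) (h1 : q ≤ 1 / 2) (m k : ℕ) :
    walkBound q (m + 1) k ≤ walkBound q m k := by
  cases k with
  | zero => simp [walkBound_zero_right]
  | succ k =>
    rw [walkBound_succ_succ]
    nlinarith [mul_le_mul_of_nonneg_left (walkBound_concave h0 h1 m k) h0]

lemma walkBound_antitone_left (h0 : 0 ≤ q) (h1 : q ≤ 1 / 2) (k : ℕ) :
    Antitone fun m => walkBound q m k :=
  antitone_nat_of_succ_le fun m => walkBound_succ_le h0 h1 m k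

/-- Spreading two arguments further apart decreases the sum, by concavity. -/
lemma walkBound_add_le {q : ℝ} (h0 : 0 ≤ q) (h1 : q ≤ 1 / 2) (m : ℕ) {k s : ℕ} (hs : 1 ≤ s)
    (hsk : s ≤ k) : walkBound q m (k + s) + walkBound q m (k - s) ≤
      walkBound q m (k + 1) + walkBound q m (k - 1) := by
  have hd : Antitone fun k => walkBound q m (k + 1) - walkBound q m k :=
    antitone_nat_of_succ_le fun k => by
      have := walkBound_concave h0 h1 m k
      simp only [Nat.add_assoc, Nat.reduceAdd] at *
      linarith
  induction s, hs using Nat.le_induction with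
  | base => exact le_rfl
  | succ s hs ih =>
    refine le_trans ?_ (ih (by omega))
    have h := hd (show k - (s + 1) ≤ k + s by omega)
    have e : k - (s + 1) + 1 = k - s := by omega
    simp only [e] at h
    rw [← Nat.add_assoc]
    linarith

lemma walkBound_one_le_half (h0 : 0 ≤ q) (h1 : q ≤ 1 / 2) (m : ℕ) :
    walkBound q m 1 ≤ (1 + (1 - 2 * q) ^ m) / 2 := by
  induction m with
  | zero => norm_num [walkBound]
  | succ m ih =>
    have h2 : 0 ≤ 1 - 2 * q := by linarith
    have a := mul_le_mul_of_nonneg_left ih h2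
    have b := mul_le_mul_of_nonneg_left (walkBound_le_one h0 h1 m 2) h0
    rw [walkBound_succ_succ, walkBound_zero_right, pow_succ]
    norm_num at a b ⊢
    nlinarith

lemma sum_second_difference (f : ℕ → ℝ) (N : ℕ) :
    ∑ k ∈ Finset.range N, (f (k + 2) + f k - 2 * f (k + 1)) = f (N + 1) - f N - (f 1 - f 0) := by
  induction N with
  | zero => simp
  | succ N ih => rw [Finset.sum_range_succ, ih]; ring

lemma sum_mul_second_difference (f : ℕ → ℝ) (N : ℕ) :
    ∑ k ∈ Finset.range N, ((k : ℝ) + 1) * (f (k + 2) + f k - 2 * f (k + 1)) =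
      (N + 1) * (f (N + 1) - f N) - (f (N + 1) - f 0) := by
  induction N with
  | zero => simp
  | succ N ih => rw [Finset.sum_range_succ, ih]; push_cast; ring

/-- The absorption probabilities, summed over the starting points, grow by
`q * walkBound q m 1` in step `m`. -/
lemma sum_one_sub_walkBound (q : ℝ) (N m : ℕ) (hm : m ≤ N) :
    ∑ k ∈ Finset.range N, (1 - walkBound q m (k + 1)) =
      q * ∑ l ∈ Finset.range m, walkBound q l 1 := by
  induction m with
  | zero => simp [walkBound_zero_succ]
  | succ m ih =>
    have h := sum_second_difference (walkBound q m) N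
    rw [walkBound_eq_one q (show m < N + 1 by omega), walkBound_eq_one q (show m < N by omega),
      walkBound_zero_right] at h
    rw [Finset.sum_range_succ, mul_add, ← ih (by omega)]
    have : ∀ k ∈ Finset.range N, 1 - walkBound q (m + 1) (k + 1) = (1 - walkBound q m (k + 1)) -
        q * (walkBound q m (k + 2) + walkBound q m k - 2 * walkBound q m (k + 1)) :=
      fun k _ => by rw [walkBound_succ_succ]; ring
    rw [Finset.sum_congr rfl this, Finset.sum_sub_distrib, ← Finset.mul_sum, h]
    ring

/-- The absorption probabilities, weighted by the starting point, grow by exactly `q` in each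
step. -/
lemma sum_mul_one_sub_walkBound (q : ℝ) (N m : ℕ) (hm : m ≤ N) :
    ∑ k ∈ Finset.range N, ((k : ℝ) + 1) * (1 - walkBound q m (k + 1)) = q * m := by
  induction m with
  | zero => simp [walkBound_zero_succ]
  | succ m ih =>
    have h := sum_mul_second_difference (walkBound q m) N
    rw [walkBound_eq_one q (show m < N + 1 by omega), walkBound_eq_one q (show m < N by omega),
      walkBound_zero_right] at h
    have : ∀ k ∈ Finset.range N, ((k : ℝ) + 1) * (1 - walkBound q (m + 1) (k + 1)) =
        ((k : ℝ) + 1) * (1 - walkBound q m (k + 1)) -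
        q * (((k : ℝ) + 1) * (walkBound q m (k + 2) + walkBound q m k -
          2 * walkBound q m (k + 1))) :=
      fun k _ => by rw [walkBound_succ_succ]; ring
    rw [Finset.sum_congr rfl this, Finset.sum_sub_distrib, ← Finset.mul_sum, h, ih (by omega)]
    push_cast
    ring

/-- The survival probability from `1` is of order `(q m)^(-1/2)`: the two moment identities
bound `q * ∑ l < m, walkBound q l 1` by `2 * √(q m)`, and the summands decrease in `l`. -/
lemma walkBound_one_le (h0 : 0 < q) (h1 : q ≤ 1 / 2) {m : ℕ} (hm : 0 < m) :
    walkBound q m 1 ≤ 2 / √(q * m) := by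
  have hqm : 0 < q * m := by positivity
  set s := √(q * m) with hs
  have hs0 : 0 < s := Real.sqrt_pos.2 hqm
  have hss : s * s = q * m := Real.mul_self_sqrt hqm.le
  have hA := sum_one_sub_walkBound q m m le_rfl
  have hB := sum_mul_one_sub_walkBound q m m le_rfl
  have hlow : (m : ℝ) * walkBound q m 1 ≤ ∑ l ∈ Finset.range m, walkBound q l 1 := by
    have := Finset.card_nsmul_le_sum (Finset.range m) (fun l => walkBound q l 1)
      (walkBound q m 1) fun l hl => walkBound_antitone_left h0.le h1 1 (Finset.mem_range.1 hl).le
    simpa using this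
  have hup : ∑ k ∈ Finset.range m, (1 - walkBound q m (k + 1)) ≤ s + s := by
    -- starting points up to `s` contribute at most `1` each, the others at most `1 / s` times
    -- their contribution to the weighted sum
    have hterm : ∀ k ∈ Finset.range m, 1 - walkBound q m (k + 1) ≤
        (if k < ⌊s⌋₊ then 1 else 0) +
          (1 / s) * (((k : ℝ) + 1) * (1 - walkBound q m (k + 1))) := fun k _ => by
      have a := walkBound_nonneg h0.le h1 m (k + 1)
      have b := walkBound_le_one h0.le h1 m (k + 1)
      split_ifs with hk
      · have : 0 ≤ (1 / s) * (((k : ℝ) + 1) * (1 - walkBound q m (k + 1))) :=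
          mul_nonneg (by positivity) (mul_nonneg (by positivity) (by linarith))
        linarith
      · have hk' : s ≤ (k : ℝ) + 1 := by
          have := Nat.lt_floor_add_one s
          have h3 : (⌊s⌋₊ : ℝ) ≤ k := by exact_mod_cast not_lt.1 hk
          linarith
        rw [← mul_assoc, zero_add]
        have : 1 ≤ 1 / s * ((k : ℝ) + 1) := by
          rw [one_div, inv_mul_eq_div, le_div_iff₀ hs0]; linarith
        nlinarith
    refine (Finset.sum_le_sum hterm).trans ?_
    rw [Finset.sum_add_distrib, ← Finset.mul_sum, hB, ← hss]
    have h3 : ∑ k ∈ Finset.range m, (if k < ⌊s⌋₊ then (1 : ℝ) else 0) ≤ s := by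
      rw [Finset.sum_boole]
      refine le_trans ?_ (Nat.floor_le hs0.le)
      have : (Finset.range m).filter (fun k => k < ⌊s⌋₊) ⊆ Finset.range ⌊s⌋₊ := fun k hk => by
        simpa using (Finset.mem_filter.1 hk).2
      exact_mod_cast (Finset.card_le_card this).trans_eq (Finset.card_range _)
    have h4 : 1 / s * (s * s) = s := by field_simp
    linarith
  rw [hA] at hup
  rw [le_div_iff₀ hs0]
  have := mul_le_mul_of_nonneg_left hlow h0.le
  have h5 : s * (walkBound q m 1 * s) ≤ s * 2 := by
    calc s * (walkBound q m 1 * s) = (s * s) * walkBound q m 1 := by ring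
      _ = q * (m * walkBound q m 1) := by rw [hss]; ring
      _ ≤ s * 2 := by linarith
  exact le_of_mul_le_mul_left h5 hs0

end WalkBound

/-- A translate by a nonzero vector of a nonempty finite set of reals is a different set. -/
lemma card_lt_card_union_image_sub {T : Finset ℝ} (hT : T.Nonempty) {a : ℝ} (ha : a ≠ 0) :
    T.card < (T ∪ T.image (· - a)).card := by
  suffices hsub : ¬ T.image (· - a) ⊆ T by
    refine Finset.card_lt_card (Finset.ssubset_iff_subset_ne.2
      ⟨Finset.subset_union_left, fun h => hsub ?_⟩)
    rw [Finset.left_eq_union] at h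
    exact h
  intro hsub
  rcases lt_or_gt_of_ne ha with ha | ha
  · have := T.le_max' _ (hsub (Finset.mem_image_of_mem _ (T.max'_mem hT)))
    linarith
  · have := T.min'_le _ (hsub (Finset.mem_image_of_mem _ (T.min'_mem hT)))
    linarith

section LittlewoodOfford

variable {ι : Type*} [Fintype ι] [DecidableEq ι] {p : ι → ℝ} {q : ℝ}

/-- Inductive form of the Littlewood–Offord bound. Exposing one more summand replaces
`P (S ∈ T)` by a mixture of `P (S ∈ T)` and `P (S ∈ T - a)`; the sum of these two is
`P (S ∈ T ∪ (T - a)) + P (S ∈ T ∩ (T - a))`, and the union is strictly larger than `T`. -/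
lemma prodPr_sum_mem_le (h0 : 0 ≤ q) (h1 : q ≤ 1 / 2) (hp : ∀ i, q ≤ p i)
    (hp' : ∀ i, p i ≤ 1 - q) (c : ι → ℝ) (J : Finset ι) (T : Finset ℝ) :
    prodPr p {y | ∑ j ∈ J, c j * (if y j then 1 else 0) ∈ T} ≤
      walkBound q (J.filter fun j => c j ≠ 0).card T.card := by
  have hp0 : ∀ i, 0 ≤ p i := fun i => h0.trans (hp i)
  have hp1 : ∀ i, p i ≤ 1 := fun i => by linarith [hp' i]
  induction J using Finset.induction_on generalizing T with
  | empty =>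
    rcases T.eq_empty_or_nonempty with rfl | hT
    · simp [prodPr_empty, walkBound_zero_right]
    · obtain ⟨k, hk⟩ := Nat.exists_eq_succ_of_ne_zero hT.card_pos.ne'
      rw [hk]
      simpa [walkBound_zero_succ] using prodPr_le_one hp0 hp1 _
  | insert a J ha ih =>
    let S : (ι → Bool) → ℝ := fun y => ∑ j ∈ J, c j * (if y j then 1 else 0)
    have hS : ∀ y b, S (Function.update y a b) = S y := fun y b =>
      Finset.sum_congr rfl fun j hj => by
        rw [Function.update_of_ne (ne_of_mem_of_not_mem hj ha)]
    have hsplit : prodPr p {y | ∑ j ∈ insert a J, c j * (if y j then 1 else 0) ∈ T} =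
        (1 - p a) * prodPr p {y | S y ∈ T} + p a * prodPr p {y | S y ∈ T.image (· - c a)} := by
      rw [prodPr_update p a]
      congr 3
      · ext y
        have := hS y false
        simp only [S] at this
        simp only [Set.mem_ofPred_eq, Finset.sum_insert ha, Function.update_self, this]
        simp [S]
      · ext y
        have := hS y true
        simp only [S] at this
        simp only [Set.mem_ofPred_eq, Finset.sum_insert ha, Function.update_self, this,
          Finset.mem_image]
        simp only [if_true, mul_one, S]
        constructor
        · exact fun h => ⟨_, h, by ring⟩
        · rintro ⟨t, ht, hty⟩
          rw [← hty]
          simpa using ht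
    rw [hsplit]
    by_cases hca : c a = 0
    · rw [hca, Finset.filter_insert, if_neg (by simpa using hca)]
      simp only [sub_zero, Finset.image_id']
      linarith [ih T]
    rcases T.eq_empty_or_nonempty with rfl | hT
    · simp [prodPr_empty, walkBound_zero_right]
    rw [Finset.filter_insert, if_pos hca, Finset.card_insert_of_notMem (by simp [ha])]
    set m := (J.filter fun j => c j ≠ 0).card
    set T' := T.image (· - c a) with hT'
    have hcard : T'.card = T.card := Finset.card_image_of_injective _ sub_left_injective
    have hlt := card_lt_card_union_image_sub hT hca
    rw [← hT'] at hlt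
    have huni := Finset.card_union_add_card_inter T T'
    have hsum : prodPr p {y | S y ∈ T} + prodPr p {y | S y ∈ T'} =
        prodPr p {y | S y ∈ T ∪ T'} + prodPr p {y | S y ∈ T ∩ T'} := by
      simp only [prodPr]
      rw [← prodExp_add, ← prodExp_add]
      congr 1
      funext y
      by_cases h1 : S y ∈ T <;> by_cases h2 : S y ∈ T' <;> simp [Set.indicator, h1, h2]
    have hU := ih (T ∪ T')
    have hI := ih (T ∩ T')
    have hTm := ih T
    have hTm' := ih T'
    rw [hcard] at hTm' huni
    have hspread := walkBound_add_le h0 h1 m (k := T.card) (s := (T ∪ T').card - T.card)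
      (by omega) (by omega)
    rw [show T.card + ((T ∪ T').card - T.card) = (T ∪ T').card by omega,
      show T.card - ((T ∪ T').card - T.card) = (T ∩ T').card by omega] at hspread
    obtain ⟨k, hk⟩ := Nat.exists_eq_succ_of_ne_zero hT.card_pos.ne'
    rw [hk, Nat.succ_eq_add_one] at hTm hTm' hspread ⊢
    rw [walkBound_succ_succ]
    simp only [Nat.add_sub_cancel, Nat.add_assoc, Nat.reduceAdd] at hspread
    have e1 : prodPr p {y | S y ∈ T} + prodPr p {y | S y ∈ T'} ≤
        walkBound q m (k + 2) + walkBound q m k := by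
      rw [hsum]; exact (add_le_add hU hI).trans hspread
    have e2 := mul_le_mul_of_nonneg_left e1 h0
    have e3 := mul_le_mul_of_nonneg_left hTm (show 0 ≤ 1 - p a - q by linarith [hp' a])
    have e4 := mul_le_mul_of_nonneg_left hTm' (show 0 ≤ p a - q by linarith [hp a])
    nlinarith

/-- **Littlewood–Offord bound**: if at least `m` of the coefficients are nonzero, then
no value of the sum has probability larger than `walkBound q m 1`. -/
lemma prodPr_sum_eq_le (h0 : 0 ≤ q) (h1 : q ≤ 1 / 2) (hp : ∀ i, q ≤ p i)
    (hp' : ∀ i, p i ≤ 1 - q) (c : ι → ℝ) {m : ℕ}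
    (hm : m ≤ (Finset.univ.filter fun j => c j ≠ 0).card) (t : ℝ) :
    prodPr p {y | ∑ j, c j * (if y j then 1 else 0) = t} ≤ walkBound q m 1 := by
  have h := prodPr_sum_mem_le h0 h1 hp hp' c Finset.univ {t}
  simp only [Finset.mem_singleton, Finset.card_singleton] at h
  exact h.trans (walkBound_antitone_left h0 h1 1 hm)

end LittlewoodOfford

/-! ### The quadratic Littlewood–Offord bound -/

section Quadratic

open Matrix

variable {ι : Type*} [Fintype ι] [DecidableEq ι] {p : ι → ℝ} {q : ℝ}

lemma dotProduct_mulVec_add_self {ι : Type*} [Fintype ι] {B : Matrix ι ι ℝ} (hB : B.IsSymm)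
    (u v : ι → ℝ) :
    (u + v) ⬝ᵥ B *ᵥ (u + v) = u ⬝ᵥ B *ᵥ u + 2 * (u ⬝ᵥ B *ᵥ v) + v ⬝ᵥ B *ᵥ v := by
  have h : v ⬝ᵥ B *ᵥ u = u ⬝ᵥ B *ᵥ v := by
    rw [dotProduct_mulVec, ← mulVec_transpose, hB.eq, dotProduct_comm]
  rw [mulVec_add, add_dotProduct, dotProduct_add, dotProduct_add, h]
  ring

/-- After decoupling, the quadratic event becomes linear in the coordinates in `U`, with
coefficients `2 * B *ᵥ (v - v')`. It is unlikely unless half of these coefficients vanish. -/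
lemma prodPr_decoupled_le (h0 : 0 ≤ q) (h1 : q ≤ 1 / 2) (hp : ∀ i, q ≤ p i)
    (hp' : ∀ i, p i ≤ 1 - q) (r : ι → ℝ) (t : ℝ) {U : Finset ι} {h : ℕ} (hh : 0 < h)
    (hU : U.card = 2 * h) :
    prodPr p {x | ∑ a, (if a ∈ U then r a else 0) * (if x a then 1 else 0) = t} ≤
      walkBound q h 1 + (1 / h) * ∑ a ∈ U, if r a = 0 then 1 else 0 := by
  have hp0 : ∀ i, 0 ≤ p i := fun i => h0.trans (hp i)
  have hp1 : ∀ i, p i ≤ 1 := fun i => by linarith [hp' i]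
  have hh' : (0 : ℝ) < h := by exact_mod_cast hh
  by_cases hc : h ≤ (Finset.univ.filter fun a => (if a ∈ U then r a else 0) ≠ 0).card
  · refine (prodPr_sum_eq_le h0 h1 hp hp' _ hc t).trans (le_add_of_nonneg_right ?_)
    exact mul_nonneg (by positivity) (Finset.sum_nonneg fun a _ => by split_ifs <;> norm_num)
  · have e : (Finset.univ.filter fun a => (if a ∈ U then r a else 0) ≠ 0) =
        U.filter fun a => ¬ r a = 0 := by
      ext a; simp
    rw [e] at hc
    have hsum := U.card_filter_add_card_filter_not (fun a => r a = 0)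
    have hz : (h : ℝ) ≤ ∑ a ∈ U, if r a = 0 then (1 : ℝ) else 0 := by
      rw [Finset.sum_boole]
      exact_mod_cast (by omega : h ≤ (U.filter fun a => r a = 0).card)
    refine (prodPr_le_one hp0 hp1 _).trans ?_
    have : 1 ≤ (1 / (h : ℝ)) * ∑ a ∈ U, if r a = 0 then (1 : ℝ) else 0 := by
      rw [one_div, inv_mul_eq_div, le_div_iff₀ hh']; linarith
    linarith [walkBound_nonneg h0 h1 h 1]

/-- **Decoupling.** By Cauchy–Schwarz, the squared probability of `A` is at most the probability
that two completions of the same vector on `U`, independent outside `U`, both lie in `A`. -/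
lemma sq_prodPr_le_decoupled (h0 : ∀ i, 0 ≤ p i) (h1 : ∀ i, p i ≤ 1) (U : Finset ι)
    (A : Set (ι → Bool)) :
    prodPr p A ^ 2 ≤ prodExp p fun z' => prodExp p fun z =>
      prodPr p {x | Uᶜ.piecewise z x ∈ A ∧ Uᶜ.piecewise z' x ∈ A} := by
  have hsq : ∀ x, (prodExp p fun z => A.indicator (1 : (ι → Bool) → ℝ) (Uᶜ.piecewise z x)) ^ 2 =
      prodExp p fun z' => prodExp p fun z =>
        ({x | Uᶜ.piecewise z x ∈ A ∧ Uᶜ.piecewise z' x ∈ A} : Set _).indicator 1 x := fun x => by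
    rw [sq, ← prodExp_mul_left]
    congr 1
    funext z'
    rw [mul_comm, ← prodExp_mul_left]
    congr 1
    funext z
    by_cases hz : Uᶜ.piecewise z x ∈ A <;> by_cases hz' : Uᶜ.piecewise z' x ∈ A <;>
      simp [Set.indicator, hz, hz']
  rw [prodPr, ← prodExp_piecewise p Uᶜ]
  refine (sq_prodExp_le h0 h1 _).trans_eq ?_
  simp only [hsq]
  rw [prodExp_comm]
  congr 1
  funext z'
  rw [prodExp_comm]
  rfl

/-- **Quadratic Littlewood–Offord bound.** Resampling the coordinates outside `U` and
applying Cauchy–Schwarz bounds the square of the probability by that of the quadratic form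
vanishing for two independent completions of the same vector on `U`; the difference of the two
values is affine in the coordinates in `U`. -/
theorem sq_prodPr_quadratic_le (h0 : 0 ≤ q) (h1 : q ≤ 1 / 2) (hp : ∀ i, q ≤ p i)
    (hp' : ∀ i, p i ≤ 1 - q) {B : Matrix ι ι ℝ} (hB : B.IsSymm) {U : Finset ι} {h : ℕ} (hh : 0 < h)
    (hU : U.card = 2 * h)
    (hrow : ∀ a ∈ U, h ≤ (Finset.univ.filter fun b => (if b ∈ U then 0 else B a b) ≠ 0).card) :
    prodPr p {y | (fun j => if y j then (1 : ℝ) else 0) ⬝ᵥ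
      B *ᵥ (fun j => if y j then (1 : ℝ) else 0) = 0} ^ 2 ≤ 3 * walkBound q h 1 := by
  have hp0 : ∀ i, 0 ≤ p i := fun i => h0.trans (hp i)
  have hp1 : ∀ i, p i ≤ 1 := fun i => by linarith [hp' i]
  have hh' : (0 : ℝ) < h := by exact_mod_cast hh
  let χ : (ι → Bool) → ι → ℝ := fun y j => if y j then 1 else 0
  let inn : (ι → Bool) → ι → ℝ := fun x j => if j ∈ U then χ x j else 0
  let out : (ι → Bool) → ι → ℝ := fun z j => if j ∈ U then 0 else χ z j
  let Q : (ι → ℝ) → ℝ := fun v => v ⬝ᵥ B *ᵥ v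
  let A : Set (ι → Bool) := {y | Q (χ y) = 0}
  let r : (ι → Bool) → (ι → Bool) → ι → ℝ := fun z z' a => 2 * ((B *ᵥ out z) a - (B *ᵥ out z') a)
  have hχ : ∀ x z, χ (Uᶜ.piecewise z x) = inn x + out z := fun x z => by
    funext j
    by_cases hj : j ∈ U <;> simp [χ, inn, out, hj]
  -- two completions of the same partial vector
  have hpair : ∀ z z', prodPr p {x | Uᶜ.piecewise z x ∈ A ∧ Uᶜ.piecewise z' x ∈ A} ≤
      walkBound q h 1 + (1 / h) * ∑ a ∈ U, if r z z' a = 0 then 1 else 0 := fun z z' => by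
    refine (prodPr_mono hp0 hp1 fun x hx => ?_).trans
      (prodPr_decoupled_le h0 h1 hp hp' (r z z') (Q (out z') - Q (out z)) hh hU)
    have hz : Q (χ (Uᶜ.piecewise z x)) = 0 := hx.1
    have hz' : Q (χ (Uᶜ.piecewise z' x)) = 0 := hx.2
    rw [hχ] at hz hz'
    simp only [Q] at hz hz'
    rw [dotProduct_mulVec_add_self hB] at hz hz'
    have hlin : ∑ a, (if a ∈ U then r z z' a else 0) * (if x a then 1 else 0) =
        2 * (inn x ⬝ᵥ B *ᵥ out z) - 2 * (inn x ⬝ᵥ B *ᵥ out z') := by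
      rw [← mul_sub, ← dotProduct_sub, dotProduct, Finset.mul_sum]
      refine Finset.sum_congr rfl fun a _ => ?_
      by_cases ha : a ∈ U
      · simp only [ha, if_true, r, inn, χ, Pi.sub_apply]; ring
      · simp [ha, inn]
    rw [Set.mem_ofPred_eq, hlin]
    simp only [Q]
    linarith
  have hzero : ∀ a ∈ U, ∀ z',
      prodExp p (fun z => if r z z' a = 0 then (1 : ℝ) else 0) ≤ walkBound q h 1 :=
    fun a ha z' => by
      refine le_trans (prodExp_mono hp0 hp1 fun z => ?_)
        (prodPr_sum_eq_le h0 h1 hp hp' _ (hrow a ha) ((B *ᵥ out z') a))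
      have hlin : ∑ b, (if b ∈ U then 0 else B a b) * (if z b then 1 else 0) = (B *ᵥ out z) a := by
        rw [mulVec, dotProduct]
        refine Finset.sum_congr rfl fun b _ => ?_
        by_cases hb : b ∈ U <;> simp [hb, out, χ]
      split_ifs with hr
      · rw [Set.indicator_of_mem]
        · rfl
        · rw [Set.mem_ofPred_eq, hlin]
          simp only [r] at hr
          linarith
      · exact Set.indicator_nonneg (fun _ _ => zero_le_one) z
  refine (sq_prodPr_le_decoupled hp0 hp1 U _).trans ?_
  calc prodExp p (fun z' => prodExp p fun z =>
        prodPr p {x | Uᶜ.piecewise z x ∈ A ∧ Uᶜ.piecewise z' x ∈ A})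
    _ ≤ prodExp p fun z' => prodExp p fun z =>
          walkBound q h 1 + (1 / h) * ∑ a ∈ U, if r z z' a = 0 then 1 else 0 :=
        prodExp_mono hp0 hp1 fun z' => prodExp_mono hp0 hp1 fun z => hpair z z'
    _ ≤ 3 * walkBound q h 1 := by
        refine prodExp_le_of_forall_le hp0 hp1 fun z' => ?_
        rw [prodExp_add, prodExp_const, prodExp_mul_left, prodExp_sum]
        have hs := Finset.sum_le_card_nsmul U _ _ fun a ha => hzero a ha z'
        rw [hU, nsmul_eq_mul] at hs
        have := mul_le_mul_of_nonneg_left hs (show 0 ≤ 1 / (h : ℝ) by positivity)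
        have e : 1 / (h : ℝ) * (((2 * h : ℕ) : ℝ) * walkBound q h 1) = 2 * walkBound q h 1 := by
          push_cast; field_simp
        linarith

end Quadratic

/-! ### Sparse near-null vectors -/

/-- The symmetric `0`-`1` matrix with zero diagonal whose off-diagonal entries are given by `x`.
The values of `x` on the diagonal of `Sym2 V` play no role. -/
def edgeMatrix {V : Type*} [DecidableEq V] (x : Sym2 V → Bool) : Matrix V V ℝ :=
  Matrix.of fun a b => if a ≠ b ∧ x s(a, b) then 1 else 0

/-- `SparseNearNull x K i j` says that some nonzero vector with fewer than `K` nonzero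
coordinates is orthogonal to all rows of `edgeMatrix x`, except possibly the rows `i` and `j`. -/
def SparseNearNull {V : Type*} [Fintype V] [DecidableEq V] (x : Sym2 V → Bool) (K : ℕ) (i j : V) :
    Prop :=
  ∃ v : V → ℝ, v ≠ 0 ∧ (Finset.univ.filter fun b => v b ≠ 0).card < K ∧
    ∀ l, l ≠ i → l ≠ j → (edgeMatrix x).mulVec v l = 0

/-- `v` has support exactly `S` and is orthogonal to the rows of `edgeMatrix x` indexed by `I`. -/
def IsNullOn {V : Type*} [Fintype V] [DecidableEq V] (x : Sym2 V → Bool) (S I : Finset V)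
    (v : V → ℝ) : Prop :=
  (∀ b, v b ≠ 0 ↔ b ∈ S) ∧ ∀ a ∈ I, (edgeMatrix x).mulVec v a = 0

/-- A vector with `IsNullOn x S I`, if there is one. It is a function of the entries of
`edgeMatrix x` in `I × S` only. -/
noncomputable def chosenNull {V : Type*} [Fintype V] [DecidableEq V] (x : Sym2 V → Bool)
    (S I : Finset V) : V → ℝ :=
  Classical.epsilon (IsNullOn x S I)

section EdgeMatrix

open Matrix

variable {V : Type*} [DecidableEq V]

lemma edgeMatrix_apply (x : Sym2 V → Bool) (a b : V) :
    edgeMatrix x a b = if a ≠ b ∧ x s(a, b) then 1 else 0 := rfl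

lemma edgeMatrix_isSymm (x : Sym2 V → Bool) : (edgeMatrix x).IsSymm := by
  ext a b
  simp only [transpose_apply, edgeMatrix_apply, Sym2.eq_swap, ne_comm]

lemma sym2_mk_injective {V : Type*} (l : V) : Function.Injective fun j : V => s(l, j) :=
  fun _ _ h => Sym2.congr_right.1 h

lemma edgeMatrix_extend_of_ne {l a b : V} (ha : a ≠ l) (hb : b ≠ l) (y : V → Bool)
    (x : Sym2 V → Bool) :
    edgeMatrix (Function.extend (fun j => s(l, j)) y x) a b = edgeMatrix x a b := by
  have : ¬ ∃ j, s(l, j) = s(a, b) := by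
    rintro ⟨j, hj⟩
    have : l ∈ s(a, b) := hj ▸ Sym2.mem_mk_left l j
    rcases Sym2.mem_iff.1 this with h | h
    · exact ha h.symm
    · exact hb h.symm
  simp only [edgeMatrix_apply, Function.extend_apply' _ _ _ this]

lemma edgeMatrix_extend_row {l b : V} (hb : b ≠ l) (y : V → Bool) (x : Sym2 V → Bool) :
    edgeMatrix (Function.extend (fun j => s(l, j)) y x) l b = if y b then 1 else 0 := by
  have := (sym2_mk_injective l).extend_apply y x b
  simp [edgeMatrix_apply, this, hb.symm]

variable [Fintype V]

lemma edgeMatrix_mulVec_extend_of_ne {l a : V} (ha : a ≠ l) {v : V → ℝ} (hv : v l = 0)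
    (y : V → Bool) (x : Sym2 V → Bool) :
    (edgeMatrix (Function.extend (fun j => s(l, j)) y x) *ᵥ v) a = (edgeMatrix x *ᵥ v) a := by
  simp only [mulVec, dotProduct]
  refine Finset.sum_congr rfl fun b _ => ?_
  by_cases hb : b = l
  · rw [hb, hv, mul_zero, mul_zero]
  · rw [edgeMatrix_extend_of_ne ha hb]

lemma edgeMatrix_mulVec_extend_self {l : V} {v : V → ℝ} (hv : v l = 0) (y : V → Bool)
    (x : Sym2 V → Bool) :
    (edgeMatrix (Function.extend (fun j => s(l, j)) y x) *ᵥ v) l =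
      ∑ b, v b * (if y b then 1 else 0) := by
  simp only [mulVec, dotProduct]
  refine Finset.sum_congr rfl fun b _ => ?_
  by_cases hb : b = l
  · rw [hb, hv, mul_zero, zero_mul]
  · rw [edgeMatrix_extend_row hb, mul_comm]

lemma chosenNull_spec {x : Sym2 V → Bool} {S I : Finset V} (h : ∃ v, IsNullOn x S I v) :
    IsNullOn x S I (chosenNull x S I) :=
  Classical.epsilon_spec h

lemma isNullOn_extend {l : V} {S I : Finset V} (hS : l ∉ S) (hI : l ∉ I) (y : V → Bool)
    (x : Sym2 V → Bool) :
    IsNullOn (Function.extend (fun j => s(l, j)) y x) S I = IsNullOn x S I := by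
  funext v
  refine propext (and_congr_right fun hv => forall₂_congr fun a ha => ?_)
  rw [edgeMatrix_mulVec_extend_of_ne (ne_of_mem_of_not_mem ha hI)]
  by_contra h
  exact hS ((hv l).1 h)

lemma chosenNull_extend {l : V} {S I : Finset V} (hS : l ∉ S) (hI : l ∉ I) (y : V → Bool)
    (x : Sym2 V → Bool) :
    chosenNull (Function.extend (fun j => s(l, j)) y x) S I = chosenNull x S I := by
  rw [chosenNull, isNullOn_extend hS hI, chosenNull]

/-- The rows outside `S ∪ I` are independent of the chosen null vector and of each
other, so each of them independently has to satisfy a Littlewood–Offord event. -/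
lemma prodPr_chosenNull_le {p : Sym2 V → ℝ} {q : ℝ} (h0 : 0 ≤ q) (h1 : q ≤ 1 / 2)
    (hp : ∀ e, q ≤ p e) (hp' : ∀ e, p e ≤ 1 - q) (S I L : Finset V) (hSL : Disjoint L S)
    (hIL : Disjoint L I) :
    prodPr p {x | (∃ v, IsNullOn x S I v) ∧
      ∀ l ∈ L, (edgeMatrix x *ᵥ chosenNull x S I) l = 0} ≤ walkBound q S.card 1 ^ L.card := by
  have hp0 : ∀ i, 0 ≤ p i := fun i => h0.trans (hp i)
  have hp1 : ∀ i, p i ≤ 1 := fun i => by linarith [hp' i]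
  induction L using Finset.induction_on with
  | empty => simpa using prodPr_le_one hp0 hp1 _
  | insert l L hl ih =>
    rw [Finset.disjoint_insert_left] at hSL hIL
    obtain ⟨hlS, hLS⟩ := hSL
    obtain ⟨hlI, hLI⟩ := hIL
    have ih := ih hLS hLI
    set F := {x : Sym2 V → Bool | (∃ v, IsNullOn x S I v) ∧
      ∀ l ∈ L, (edgeMatrix x *ᵥ chosenNull x S I) l = 0} with hF
    have hzero : ∀ x, (∃ v, IsNullOn x S I v) → chosenNull x S I l = 0 := fun x hx => by
      by_contra h
      exact hlS (((chosenNull_spec hx).1 l).1 h)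
    have hw := walkBound_nonneg h0 h1 S.card 1
    have key : prodPr p (F ∩ {x | (edgeMatrix x *ᵥ chosenNull x S I) l = 0}) ≤
        walkBound q S.card 1 * prodPr p F := by
      refine prodPr_inter_le hp0 hp1 (sym2_mk_injective l) (fun x y hx => ?_) fun x hx => ?_
      · obtain ⟨hx1, hx2⟩ := hx
        rw [isNullOn_extend hlS hlI] at hx1
        refine ⟨hx1, fun a ha => ?_⟩
        have := hx2 a ha
        rwa [chosenNull_extend hlS hlI, edgeMatrix_mulVec_extend_of_ne
          (ne_of_mem_of_not_mem ha hl) (hzero x hx1)] at this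
      · obtain ⟨hx1, -⟩ := hx
        have hsupp : (Finset.univ.filter fun b => chosenNull x S I b ≠ 0) = S := by
          ext b
          simpa using (chosenNull_spec hx1).1 b
        refine (prodPr_mono (fun _ => hp0 _) (fun _ => hp1 _) fun y hy => ?_).trans
          (prodPr_sum_eq_le h0 h1 (fun _ => hp _) (fun _ => hp' _) (chosenNull x S I)
            (by rw [hsupp]) 0)
        simp only [Set.mem_ofPred_eq] at hy ⊢
        rwa [chosenNull_extend hlS hlI, edgeMatrix_mulVec_extend_self (hzero x hx1)] at hy
    rw [Finset.card_insert_of_notMem hl, pow_succ, mul_comm]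
    refine le_trans (prodPr_mono hp0 hp1 fun x hx => ?_)
      (key.trans (mul_le_mul_of_nonneg_left ih hw))
    exact ⟨⟨hx.1, fun a ha => hx.2 a (Finset.mem_insert_of_mem ha)⟩,
      hx.2 l (Finset.mem_insert_self l L)⟩

/-- Among the rows in `R`, restricted to the columns in `S`, some `S.card` rows span
all the others. -/
lemma exists_spanning_rows (M : Matrix V V ℝ) (S R : Finset V) (hSR : S.card ≤ R.card) :
    ∃ I ⊆ R, I.card = S.card ∧ ∀ v : V → ℝ, (∀ b, v b ≠ 0 → b ∈ S) →
      (∀ a ∈ I, (M *ᵥ v) a = 0) → ∀ a ∈ R, (M *ᵥ v) a = 0 := by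
  let r : R → S → ℝ := fun a s => M a s
  obtain ⟨κ, f, hf, hspan, hind⟩ := exists_linearIndependent' ℝ r
  have : Fintype κ := Fintype.ofInjective f hf
  have hκ : Fintype.card κ ≤ S.card := by simpa using hind.fintype_card_le_finrank
  let I₀ : Finset V := Finset.univ.image fun k => (f k : V)
  have hI₀R : I₀ ⊆ R := fun a ha => by
    obtain ⟨k, -, rfl⟩ := Finset.mem_image.1 ha
    exact (f k).2
  obtain ⟨I, hI₀I, hIR, hIc⟩ := Finset.exists_subsuperset_card_eq hI₀R
    (Finset.card_image_le.trans hκ) hSR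
  refine ⟨I, hIR, hIc, fun v hv hnull a ha => ?_⟩
  let φ : (S → ℝ) →ₗ[ℝ] ℝ := Fintype.linearCombination ℝ fun s : S => v s
  have hφ : ∀ a : R, φ (r a) = (M *ᵥ v) a := fun a => by
    rw [Fintype.linearCombination_apply, mulVec, dotProduct]
    simp only [smul_eq_mul, r]
    rw [Finset.sum_coe_sort S fun s => M a s * v s]
    refine Finset.sum_subset (Finset.subset_univ S) fun b _ hb => ?_
    rw [not_not.1 (mt (hv b) hb), mul_zero]
  have hle : Submodule.span ℝ (Set.range r) ≤ LinearMap.ker φ := by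
    rw [← hspan, Submodule.span_le]
    rintro _ ⟨k, rfl⟩
    rw [SetLike.mem_coe, LinearMap.mem_ker, Function.comp_apply, hφ]
    exact hnull _ (hI₀I (Finset.mem_image_of_mem _ (Finset.mem_univ k)))
  have := hle (Submodule.subset_span ⟨⟨a, ha⟩, rfl⟩)
  rwa [LinearMap.mem_ker, hφ] at this

lemma SparseNearNull.exists_chosenNull {x : Sym2 V → Bool} {K : ℕ} {i j : V}
    (hx : SparseNearNull x K i j) (hK : 2 * K + 2 ≤ Fintype.card V) :
    ∃ k ∈ Finset.Ico 1 K, ∃ S ∈ Finset.powersetCard k Finset.univ,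
      ∃ I ∈ Finset.powersetCard k Finset.univ, (∃ v, IsNullOn x S I v) ∧
        ∀ l ∈ ((S ∪ {i, j}) ∪ I)ᶜ, (edgeMatrix x *ᵥ chosenNull x S I) l = 0 := by
  obtain ⟨v, hv0, hvK, hv⟩ := hx
  set S := Finset.univ.filter fun b => v b ≠ 0 with hS
  have hS1 : 1 ≤ S.card := by
    obtain ⟨b, hb⟩ := Function.ne_iff.1 hv0
    exact Finset.card_pos.2 ⟨b, by simpa [hS] using hb⟩
  have hR : S.card ≤ (S ∪ {i, j})ᶜ.card := by
    have a := Finset.card_union_le S {i, j}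
    have b := Finset.card_le_two (a := i) (b := j)
    rw [Finset.card_compl]
    omega
  obtain ⟨I, hIR, hIc, hI⟩ := exists_spanning_rows (edgeMatrix x) S _ hR
  have hvR : ∀ a ∈ (S ∪ {i, j})ᶜ, (edgeMatrix x *ᵥ v) a = 0 := fun a ha => by
    simp only [Finset.mem_compl, Finset.mem_union, Finset.mem_insert, Finset.mem_singleton,
      not_or] at ha
    exact hv a ha.2.1 ha.2.2
  have hex : ∃ v, IsNullOn x S I v := ⟨v, fun b => by simp [hS], fun a ha => hvR a (hIR ha)⟩
  refine ⟨S.card, Finset.mem_Ico.2 ⟨hS1, hvK⟩, S, by simp, I, by simpa using hIc, hex,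
    fun l hl => ?_⟩
  have hspec := chosenNull_spec hex
  refine hI _ (fun b => (hspec.1 b).1) hspec.2 l ?_
  rw [Finset.compl_union] at hl
  exact (Finset.mem_inter.1 hl).1

/-- Union bound over the two exempt rows, the support and the spanning rows. -/
theorem prodPr_sparseNearNull_le {p : Sym2 V → ℝ} {q : ℝ} (h0 : 0 ≤ q) (h1 : q ≤ 1 / 2)
    (hp : ∀ e, q ≤ p e) (hp' : ∀ e, p e ≤ 1 - q) {K : ℕ} (hK : 2 * K + 2 ≤ Fintype.card V) :
    prodPr p {x : Sym2 V → Bool | ∃ i j, SparseNearNull x K i j} ≤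
      ∑ k ∈ Finset.Ico 1 K, (Fintype.card V : ℝ) ^ (2 * k + 2) *
        walkBound q k 1 ^ (Fintype.card V - (2 * k + 2)) := by
  have hp0 : ∀ i, 0 ≤ p i := fun i => h0.trans (hp i)
  have hp1 : ∀ i, p i ≤ 1 := fun i => by linarith [hp' i]
  set n := Fintype.card V with hn
  let E : V → V → Finset V → Finset V → Set (Sym2 V → Bool) := fun i j S I =>
    {x | (∃ v, IsNullOn x S I v) ∧
      ∀ l ∈ ((S ∪ {i, j}) ∪ I)ᶜ, (edgeMatrix x *ᵥ chosenNull x S I) l = 0}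
  have hE : ∀ k, ∀ i j S I, S ∈ Finset.powersetCard k Finset.univ →
      I ∈ Finset.powersetCard k Finset.univ →
      prodPr p (E i j S I) ≤ walkBound q k 1 ^ (n - (2 * k + 2)) := fun k i j S I hS hI => by
    have hS := (Finset.mem_powersetCard.1 hS).2
    have hI := (Finset.mem_powersetCard.1 hI).2
    refine (prodPr_chosenNull_le h0 h1 hp hp' S I _ ?_ ?_).trans ?_
    · refine Finset.disjoint_left.2 fun a ha ha' => Finset.mem_compl.1 ha ?_
      simp [ha']
    · refine Finset.disjoint_left.2 fun a ha ha' => Finset.mem_compl.1 ha ?_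
      simp [ha']
    · rw [hS]
      refine pow_le_pow_of_le_one (walkBound_nonneg h0 h1 _ _) (walkBound_le_one h0 h1 _ _) ?_
      have a := Finset.card_union_le S {i, j}
      have b := Finset.card_le_two (a := i) (b := j)
      have c := Finset.card_union_le (S ∪ {i, j}) I
      rw [Finset.card_compl]
      omega
  have hsub : {x : Sym2 V → Bool | ∃ i j, SparseNearNull x K i j} ⊆
      ⋃ k ∈ Finset.Ico 1 K, ⋃ i ∈ (Finset.univ : Finset V), ⋃ j ∈ (Finset.univ : Finset V),
        ⋃ S ∈ Finset.powersetCard k (Finset.univ : Finset V),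
          ⋃ I ∈ Finset.powersetCard k (Finset.univ : Finset V), E i j S I := by
    rintro x ⟨i, j, hx⟩
    obtain ⟨k, hk, S, hS, I, hI, h⟩ := hx.exists_chosenNull hK
    simp only [Set.mem_iUnion]
    exact ⟨k, hk, i, Finset.mem_univ i, j, Finset.mem_univ j, S, hS, I, hI, h⟩
  refine (prodPr_mono hp0 hp1 hsub).trans ((prodPr_biUnion_le hp0 hp1 _ _).trans
    (Finset.sum_le_sum fun k _ => ?_))
  have hw : 0 ≤ walkBound q k 1 ^ (n - (2 * k + 2)) := pow_nonneg (walkBound_nonneg h0 h1 _ _) _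
  have hchoose : ((Finset.powersetCard k (Finset.univ : Finset V)).card : ℝ) ≤ (n : ℝ) ^ k := by
    rw [Finset.card_powersetCard, Finset.card_univ]
    exact_mod_cast Nat.choose_le_pow n k
  have hI : ∀ i j, ∀ S ∈ Finset.powersetCard k (Finset.univ : Finset V),
      prodPr p (⋃ I ∈ Finset.powersetCard k (Finset.univ : Finset V), E i j S I) ≤
        (n : ℝ) ^ k * walkBound q k 1 ^ (n - (2 * k + 2)) := fun i j S hS => by
    refine (prodPr_biUnion_le hp0 hp1 _ _).trans
      ((Finset.sum_le_card_nsmul _ _ _ fun I hI => hE k i j S I hS hI).trans ?_)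
    rw [nsmul_eq_mul]
    exact mul_le_mul_of_nonneg_right hchoose hw
  have hS : ∀ i j, prodPr p (⋃ S ∈ Finset.powersetCard k (Finset.univ : Finset V),
      ⋃ I ∈ Finset.powersetCard k (Finset.univ : Finset V), E i j S I) ≤
        (n : ℝ) ^ k * ((n : ℝ) ^ k * walkBound q k 1 ^ (n - (2 * k + 2))) := fun i j => by
    refine (prodPr_biUnion_le hp0 hp1 _ _).trans
      ((Finset.sum_le_card_nsmul _ _ _ fun S hS => hI i j S hS).trans ?_)
    rw [nsmul_eq_mul]
    exact mul_le_mul_of_nonneg_right hchoose (by positivity)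
  refine (prodPr_biUnion_le hp0 hp1 _ _).trans ((Finset.sum_le_card_nsmul _ _
    (n * ((n : ℝ) ^ k * ((n : ℝ) ^ k * walkBound q k 1 ^ (n - (2 * k + 2))))) fun i _ => ?_).trans
      ?_)
  · refine (prodPr_biUnion_le hp0 hp1 _ _).trans
      ((Finset.sum_le_card_nsmul _ _ _ fun j _ => hS i j).trans ?_)
    rw [nsmul_eq_mul, Finset.card_univ]
  · rw [nsmul_eq_mul, Finset.card_univ, ← hn]
    refine le_of_eq ?_
    ring

end EdgeMatrix

/-! ### Exposing a vertex -/

/-- The variant of `SparseNearNull` for the principal minor with the vertex `i` deleted: the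
sparse vector vanishes at `i`, and one further row `a` is exempt. It does not depend on the row `i`
of `edgeMatrix x`. -/
def SparseNearNullOff {V : Type*} [Fintype V] [DecidableEq V] (x : Sym2 V → Bool) (K : ℕ) (i : V) :
    Prop :=
  ∃ (a : V) (w : V → ℝ), w ≠ 0 ∧ w i = 0 ∧ (Finset.univ.filter fun b => w b ≠ 0).card < K ∧
    ∀ l, l ≠ i → l ≠ a → (edgeMatrix x).mulVec w l = 0

/-- The matrix `A` with the row and the column `i` replaced by those of the identity. -/
def isolateVertex {V : Type*} [DecidableEq V] (A : Matrix V V ℝ) (i : V) : Matrix V V ℝ :=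
  Matrix.of fun a b => if a = i ∨ b = i then (if a = b then 1 else 0) else A a b

section Exposure

open Matrix

variable {V : Type*} [DecidableEq V]

lemma isolateVertex_apply (A : Matrix V V ℝ) (i a b : V) :
    isolateVertex A i a b = if a = i ∨ b = i then (if a = b then 1 else 0) else A a b := rfl

lemma isolateVertex_isSymm {A : Matrix V V ℝ} (hA : A.IsSymm) (i : V) :
    (isolateVertex A i).IsSymm := by
  ext a b
  simp only [transpose_apply, isolateVertex_apply, or_comm, eq_comm, hA.apply]

variable [Fintype V]

lemma isolateVertex_mulVec_self (A : Matrix V V ℝ) (i : V) (w : V → ℝ) :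
    (isolateVertex A i *ᵥ w) i = w i := by
  simp [mulVec, dotProduct, isolateVertex_apply]

lemma isolateVertex_mulVec_of_ne (A : Matrix V V ℝ) {i l : V} (hl : l ≠ i) {w : V → ℝ}
    (hw : w i = 0) : (isolateVertex A i *ᵥ w) l = (A *ᵥ w) l := by
  simp only [mulVec, dotProduct]
  refine Finset.sum_congr rfl fun b _ => ?_
  by_cases hb : b = i
  · rw [hb, hw, mul_zero, mul_zero]
  · simp [isolateVertex_apply, hl, hb]

/-- A null vector with `v i ≠ 0` expresses the row `i` through the other rows; normalized, it
solves a linear system for the minor without `i`, whose right side is the exposed row. -/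
lemma exists_solution_of_null {x : Sym2 V → Bool} {i : V} {y : V → Bool} {v : V → ℝ}
    (hvi : v i ≠ 0) (hv : edgeMatrix (Function.extend (fun j => s(i, j)) y x) *ᵥ v = 0) :
    ∃ u : V → ℝ, u i = 0 ∧ (∀ l, l ≠ i → (edgeMatrix x *ᵥ u) l = if y l then 1 else 0) ∧
      ∑ b, u b * (if y b then 1 else 0) = 0 := by
  set M := edgeMatrix (Function.extend (fun j => s(i, j)) y x) with hM
  let u : V → ℝ := fun b => if b = i then 0 else -(v b / v i)
  have hu : u i = 0 := by simp [u]
  have hvu : v = (-v i) • (u - Pi.single i 1) := by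
    funext b
    by_cases hb : b = i
    · subst hb; simp [u]
    · simp only [u, hb, Pi.smul_apply, Pi.sub_apply, if_false, Pi.single_eq_of_ne hb, smul_eq_mul]
      field_simp
      ring
  have hMu : ∀ l, (M *ᵥ u) l = M l i := fun l => by
    have h := congrFun hv l
    rw [hvu, mulVec_smul, mulVec_sub, Pi.smul_apply, Pi.sub_apply, mulVec_single_one,
      Pi.zero_apply, smul_eq_mul, mul_eq_zero, neg_eq_zero, or_iff_right hvi] at h
    exact sub_eq_zero.1 h
  refine ⟨u, hu, fun l hl => ?_, ?_⟩
  · rw [← edgeMatrix_mulVec_extend_of_ne hl hu y x, ← hM, hMu, hM,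
      ← (edgeMatrix_isSymm _).apply, edgeMatrix_extend_row hl]
  · rw [← edgeMatrix_mulVec_extend_self hu y x, ← hM, hMu, hM, edgeMatrix_apply]
    simp

/-- **Exposing one vertex.** If the minor without `i` has no sparse near-null vectors,
then the exposed row rarely creates a null vector that involves `i`. When the minor is singular,
the row has to be orthogonal to a dense null vector of it; when it is invertible, the row has
to annihilate the quadratic form of the inverse, all of whose rows are dense. -/
lemma prodPr_exists_null_extend_le {p : V → ℝ} {q : ℝ} (h0 : 0 ≤ q) (h1 : q ≤ 1 / 2)
    (hp : ∀ e, q ≤ p e) (hp' : ∀ e, p e ≤ 1 - q) {h : ℕ} (hh : 0 < h)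
    (hV : 2 * h + 1 ≤ Fintype.card V) {x : Sym2 V → Bool} {i : V}
    (hx : ¬ SparseNearNullOff x (4 * h) i) :
    prodPr p {y | ∃ v : V → ℝ, v i ≠ 0 ∧
      edgeMatrix (Function.extend (fun j => s(i, j)) y x) *ᵥ v = 0} ≤
      √(3 * walkBound q h 1) := by
  have hp0 : ∀ i, 0 ≤ p i := fun i => h0.trans (hp i)
  have hp1 : ∀ i, p i ≤ 1 := fun i => by linarith [hp' i]
  have hdense : ∀ (a : V) (w : V → ℝ), w ≠ 0 → w i = 0 →
      (∀ l, l ≠ i → l ≠ a → (edgeMatrix x *ᵥ w) l = 0) →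
      4 * h ≤ (Finset.univ.filter fun b => w b ≠ 0).card := fun a w hw hwi hwl =>
    not_lt.1 fun hlt => hx ⟨a, w, hw, hwi, hlt, hwl⟩
  set A := edgeMatrix x with hA
  have hAs : A.IsSymm := edgeMatrix_isSymm x
  by_cases hsing : ∃ w : V → ℝ, w ≠ 0 ∧ isolateVertex A i *ᵥ w = 0
  · obtain ⟨w, hw, hAw⟩ := hsing
    have hwi : w i = 0 := by rw [← isolateVertex_mulVec_self A i w, hAw, Pi.zero_apply]
    have hwl : ∀ l, l ≠ i → (A *ᵥ w) l = 0 := fun l hl => by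
      rw [← isolateVertex_mulVec_of_ne A hl hwi, hAw, Pi.zero_apply]
    have hcard := hdense i w hw hwi fun l hl _ => hwl l hl
    have hG0 := walkBound_nonneg h0 h1 h 1
    have hG1 := walkBound_le_one h0 h1 h 1
    calc _ ≤ prodPr p {y | ∑ b, w b * (if y b then 1 else 0) = 0} := by
          refine prodPr_mono hp0 hp1 ?_
          rintro y ⟨v, hvi, hv⟩
          obtain ⟨u, hui, hu, -⟩ := exists_solution_of_null hvi hv
          rw [← hA] at hu
          calc ∑ b, w b * (if y b then 1 else 0) = w ⬝ᵥ A *ᵥ u := by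
                refine Finset.sum_congr rfl fun b _ => ?_
                by_cases hb : b = i
                · rw [hb, hwi, zero_mul, zero_mul]
                · rw [hu b hb]
            _ = (A *ᵥ w) ⬝ᵥ u := by rw [dotProduct_mulVec, ← mulVec_transpose, hAs.eq]
            _ = 0 := Finset.sum_eq_zero fun b _ => by
                by_cases hb : b = i
                · rw [hb, hui, mul_zero]
                · rw [hwl b hb, zero_mul]
      _ ≤ walkBound q h 1 := prodPr_sum_eq_le h0 h1 hp hp' w (by omega) 0
      _ ≤ √(3 * walkBound q h 1) := Real.le_sqrt_of_sq_le (by nlinarith)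
  · have hdet : IsUnit (isolateVertex A i).det := by
      rw [isUnit_iff_ne_zero]
      exact fun h => hsing (exists_mulVec_eq_zero_iff.2 h)
    set B := (isolateVertex A i)⁻¹ with hBdef
    have hBs : B.IsSymm := by
      rw [IsSymm, hBdef, transpose_nonsing_inv, (isolateVertex_isSymm hAs i).eq]
    let B' : Matrix V V ℝ := Matrix.of fun a b => if a = i ∨ b = i then 0 else B a b
    have hB' : ∀ a b, B' a b = if a = i ∨ b = i then 0 else B a b := fun _ _ => rfl
    have hB's : B'.IsSymm := by
      ext a b
      simp only [transpose_apply, hB', or_comm, hBs.apply]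
    obtain ⟨U, hUi, hUc⟩ := Finset.exists_subset_card_eq (s := ({i} : Finset V)ᶜ) (n := 2 * h)
      (by rw [Finset.card_compl, Finset.card_singleton]; omega)
    have hrow : ∀ a ∈ U,
        h ≤ (Finset.univ.filter fun b => (if b ∈ U then 0 else B' a b) ≠ 0).card := fun a ha => by
      have hai : a ≠ i := by simpa using hUi ha
      let w : V → ℝ := fun b => B b a
      have hAw : isolateVertex A i *ᵥ w = Pi.single a 1 := by
        have : w = B *ᵥ Pi.single a 1 := by rw [mulVec_single_one]; rfl
        rw [this, mulVec_mulVec, mul_nonsing_inv _ hdet, one_mulVec]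
      have hwi : w i = 0 := by
        rw [← isolateVertex_mulVec_self A i w, hAw, Pi.single_eq_of_ne hai.symm]
      have hw : w ≠ 0 := fun hw => by
        have := congrFun hAw a
        rw [hw, mulVec_zero, Pi.single_eq_same] at this
        exact zero_ne_one this
      have hcard := hdense a w hw hwi fun l hl hla => by
        rw [← isolateVertex_mulVec_of_ne A hl hwi, hAw, Pi.single_eq_of_ne hla]
      have hsub : (Finset.univ.filter fun b => w b ≠ 0) ⊆
          (Finset.univ.filter fun b => (if b ∈ U then 0 else B' a b) ≠ 0) ∪ U := fun b hb => by
        have hb : w b ≠ 0 := (Finset.mem_filter.1 hb).2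
        by_cases hbU : b ∈ U
        · exact Finset.mem_union_right _ hbU
        · refine Finset.mem_union_left _ (Finset.mem_filter.2 ⟨Finset.mem_univ b, ?_⟩)
          have hbi : b ≠ i := fun h => hb (h ▸ hwi)
          rw [if_neg hbU, hB', if_neg (by tauto), hBs.apply]
          exact hb
      have := (Finset.card_le_card hsub).trans (Finset.card_union_le _ _)
      omega
    refine (prodPr_mono hp0 hp1 ?_).trans
      (Real.le_sqrt_of_sq_le (sq_prodPr_quadratic_le h0 h1 hp hp' hB's hh hUc hrow))
    rintro y ⟨v, hvi, hv⟩
    obtain ⟨u, hui, hu, hsum⟩ := exists_solution_of_null hvi hv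
    rw [← hA] at hu
    have hAu : isolateVertex A i *ᵥ u = fun l => if l = i then 0 else if y l then 1 else 0 := by
      funext l
      by_cases hl : l = i
      · rw [hl, isolateVertex_mulVec_self, hui, if_pos rfl]
      · rw [isolateVertex_mulVec_of_ne A hl hui, hu l hl, if_neg hl]
    have huB : u = B *ᵥ fun l => if l = i then 0 else if y l then 1 else 0 := by
      rw [← hAu, mulVec_mulVec, nonsing_inv_mul _ hdet, one_mulVec]
    have hB'u : (B' *ᵥ fun j => if y j then (1 : ℝ) else 0) = u := by
      funext a
      by_cases ha : a = i
      · rw [ha, hui]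
        exact Finset.sum_eq_zero fun b _ => by simp [hB']
      · rw [huB]
        simp only [mulVec, dotProduct]
        refine Finset.sum_congr rfl fun b _ => ?_
        by_cases hb : b = i <;> simp [hB', ha, hb]
    rw [Set.mem_ofPred_eq, hB'u, dotProduct_comm]
    exact hsum

lemma sparseNearNullOff_extend {x : Sym2 V → Bool} {K : ℕ} {i : V} (y : V → Bool) :
    SparseNearNullOff (Function.extend (fun j => s(i, j)) y x) K i ↔ SparseNearNullOff x K i := by
  refine exists₂_congr fun a w => and_congr_right fun _ => and_congr_right fun hwi =>
    and_congr_right fun _ => forall₂_congr fun l hl => ?_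
  rw [edgeMatrix_mulVec_extend_of_ne hl hwi]

/-- Outside the sparse event, a nonzero null vector involves at least `4 * h` vertices.
Averaging over the vertices therefore loses only a factor `n / (4 * h)` compared with exposing
a single vertex. -/
theorem prodPr_singular_le {p : Sym2 V → ℝ} {q : ℝ} (h0 : 0 ≤ q) (h1 : q ≤ 1 / 2)
    (hp : ∀ e, q ≤ p e) (hp' : ∀ e, p e ≤ 1 - q) {h : ℕ} (hh : 0 < h)
    (hV : 2 * h + 1 ≤ Fintype.card V) :
    prodPr p {x | ∃ v : V → ℝ, v ≠ 0 ∧ edgeMatrix x *ᵥ v = 0} ≤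
      prodPr p {x : Sym2 V → Bool | ∃ i j, SparseNearNull x (4 * h) i j} +
        1 / (4 * h) * (Fintype.card V * √(3 * walkBound q h 1)) := by
  have hp0 : ∀ i, 0 ≤ p i := fun i => h0.trans (hp i)
  have hp1 : ∀ i, p i ≤ 1 := fun i => by linarith [hp' i]
  have hh' : (0 : ℝ) < h := by exact_mod_cast hh
  let F : V → Set (Sym2 V → Bool) := fun i => {x | ¬ SparseNearNullOff x (4 * h) i}
  let N : V → Set (Sym2 V → Bool) := fun i => {x | ∃ v : V → ℝ, v i ≠ 0 ∧ edgeMatrix x *ᵥ v = 0}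
  let S : Set (Sym2 V → Bool) := {x | ∃ i j, SparseNearNull x (4 * h) i j}
  have hFN : ∀ i, prodPr p (F i ∩ N i) ≤ √(3 * walkBound q h 1) := fun i => by
    refine (prodPr_inter_le hp0 hp1 (F := F i) (B := N i) (sym2_mk_injective i)
      (r := √(3 * walkBound q h 1))
      (fun x y hxy hx => hxy ((sparseNearNullOff_extend y).2 hx)) fun x hx => ?_).trans ?_
    · exact prodPr_exists_null_extend_le h0 h1 (fun _ => hp _) (fun _ => hp' _) hh hV hx
    · exact mul_le_of_le_one_right (Real.sqrt_nonneg _) (prodPr_le_one hp0 hp1 _)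
  have hmain : prodPr p {x | ∃ v : V → ℝ, v ≠ 0 ∧ edgeMatrix x *ᵥ v = 0} ≤
      prodPr p S + 1 / (4 * h) * ∑ i, prodPr p (F i ∩ N i) := by
    simp only [prodPr]
    rw [← prodExp_sum, ← prodExp_mul_left, ← prodExp_add]
    refine prodExp_mono hp0 hp1 fun x => ?_
    have hnn : ∀ i, (0 : ℝ) ≤ (F i ∩ N i).indicator 1 x :=
      fun i => Set.indicator_nonneg (fun _ _ => zero_le_one) x
    have hsum : (0 : ℝ) ≤ 1 / (4 * h) * ∑ i, (F i ∩ N i).indicator (1 : (Sym2 V → Bool) → ℝ) x :=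
      mul_nonneg (by positivity) (Finset.sum_nonneg fun i _ => hnn i)
    by_cases hx : ∃ v : V → ℝ, v ≠ 0 ∧ edgeMatrix x *ᵥ v = 0
    · rw [Set.indicator_of_mem (by exact hx)]
      by_cases hxS : x ∈ S
      · rw [Set.indicator_of_mem hxS]
        linarith
      rw [Set.indicator_of_notMem hxS, zero_add]
      obtain ⟨v, hv0, hv⟩ := hx
      obtain ⟨i₀, -⟩ := Function.ne_iff.1 hv0
      have hcard : 4 * h ≤ (Finset.univ.filter fun b => v b ≠ 0).card :=
        not_lt.1 fun hlt => hxS ⟨i₀, i₀, v, hv0, hlt, fun l _ _ => by rw [hv, Pi.zero_apply]⟩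
      have hone : ∀ i ∈ Finset.univ.filter (fun b => v b ≠ 0),
          (F i ∩ N i).indicator (1 : (Sym2 V → Bool) → ℝ) x = 1 := fun i hi => by
        rw [Set.indicator_of_mem, Pi.one_apply]
        refine ⟨?_, v, (Finset.mem_filter.1 hi).2, hv⟩
        rintro ⟨a, w, hw, -, hwc, hwl⟩
        exact hxS ⟨i, a, w, hw, hwc, hwl⟩
      have hle : ((4 * h : ℕ) : ℝ) ≤ ∑ i, (F i ∩ N i).indicator (1 : (Sym2 V → Bool) → ℝ) x := by
        refine le_trans ?_ (Finset.sum_le_sum_of_subset_of_nonneg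
          (Finset.subset_univ (Finset.univ.filter fun b => v b ≠ 0)) fun i _ _ => hnn i)
        rw [Finset.sum_congr rfl hone, Finset.sum_const, nsmul_eq_mul, mul_one]
        exact_mod_cast hcard
      push_cast at hle
      rw [Pi.one_apply, one_div, inv_mul_eq_div, le_div_iff₀ (by positivity)]
      linarith
    · rw [Set.indicator_of_notMem (by exact hx)]
      exact add_nonneg (Set.indicator_nonneg (fun _ _ => zero_le_one) x) hsum
  refine hmain.trans (add_le_add le_rfl (mul_le_mul_of_nonneg_left ?_ (by positivity)))
  refine (Finset.sum_le_card_nsmul _ _ _ fun i _ => hFN i).trans_eq ?_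
  rw [nsmul_eq_mul, Finset.card_univ]

end Exposure

/-! ### The law of the random graph -/

section Transfer

open Matrix

/-- The edge probabilities as a function on unordered pairs; the value on the diagonal is
irrelevant and set to `1 / 2`. -/
noncomputable def pairProb {n : ℕ} (p : Fin n → Fin n → ℝ) (e : Sym2 (Fin n)) : ℝ :=
  if e.inf < e.sup then p e.inf e.sup else 1 / 2

lemma pairProb_mk {n : ℕ} (p : Fin n → Fin n → ℝ) {i j : Fin n} (h : i < j) :
    pairProb p s(i, j) = p i j := by
  simp [pairProb, h, h.le]

lemma sym2_mk_val_injective {n : ℕ} :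
    Function.Injective fun e : {e : Fin n × Fin n // e.1 < e.2} => s(e.1.1, e.1.2) := by
  rintro ⟨⟨a, b⟩, hab⟩ ⟨⟨c, d⟩, hcd⟩ h
  rcases Sym2.eq_iff.1 h with ⟨h1, h2⟩ | ⟨h1, h2⟩
  · simp_all
  · simp only at h1 h2 hab hcd
    subst h1 h2
    exact absurd hab hcd.asymm

/-- The adjacency matrix only depends on the pairs `i < j`. -/
lemma realAdjMatrix_eq_edgeMatrix {n : ℕ} (G : SimpleGraph (Fin n)) (x : Sym2 (Fin n) → Bool)
    (h : ∀ i j : Fin n, i < j → (G.Adj i j ↔ x s(i, j))) : realAdjMatrix G = edgeMatrix x := by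
  have h' : ∀ i j : Fin n, i ≠ j → (G.Adj i j ↔ x s(i, j)) := fun i j hij => by
    rcases lt_or_gt_of_ne hij with hij | hij
    · exact h i j hij
    · rw [G.adj_comm, Sym2.eq_swap, h j i hij]
  ext i j
  rw [realAdjMatrix, SimpleGraph.adjMatrix_apply, edgeMatrix_apply]
  by_cases hij : i = j
  · simp [hij]
  · simp [hij, h' i j hij]

lemma exists_null_of_rank_lt {n : ℕ} {A : Matrix (Fin n) (Fin n) ℝ} (h : A.rank < n) :
    ∃ v : Fin n → ℝ, v ≠ 0 ∧ A *ᵥ v = 0 := by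
  rw [exists_mulVec_eq_zero_iff]
  by_contra hdet
  have := rank_of_isUnit A ((isUnit_iff_isUnit_det A).2 (isUnit_iff_ne_zero.2 hdet))
  rw [Fintype.card_fin] at this
  omega

/-- The probability of singularity is computed under the product of Bernoulli laws, which is the
law of the edge indicators. -/
lemma IsIndepEdgeRandomGraph.measureReal_le {n : ℕ} {p : Fin n → Fin n → ℝ} {Ω : Type*}
    [MeasurableSpace Ω] {μ : Measure Ω} [IsProbabilityMeasure μ] {G : Ω → SimpleGraph (Fin n)}
    (hG : IsIndepEdgeRandomGraph p μ G) :
    μ.real {ω | (realAdjMatrix (G ω)).rank < n} ≤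
      prodPr (pairProb p) {x | ∃ v : Fin n → ℝ, v ≠ 0 ∧ edgeMatrix x *ᵥ v = 0} := by
  classical
  let φ : {e : Fin n × Fin n // e.1 < e.2} → Sym2 (Fin n) := fun e => s(e.1.1, e.1.2)
  have hφ : Function.Injective φ := sym2_mk_val_injective
  let A : {e : Fin n × Fin n // e.1 < e.2} → Set Ω := fun e => {ω | (G ω).Adj e.1.1 e.1.2}
  have hAm : ∀ e, MeasurableSet (A e) := fun e => hG.measurableSet_adj _ _ e.2
  -- the event that the edge indicators are given by `c`
  let Y : ({e : Fin n × Fin n // e.1 < e.2} → Bool) → Set Ω :=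
    fun c => ⋂ e, if c e then A e else (A e)ᶜ
  have hY : ∀ c, μ.real (Y c) = ∏ e, if c e then (pairProb p ∘ φ) e else 1 - (pairProb p ∘ φ) e :=
    fun c => by
      have hind := (iIndepSet_iff_iIndep _ _).1 hG.indep_adj
      have hgen : ∀ e, MeasurableSet[MeasurableSpace.generateFrom {A e}]
          (if c e then A e else (A e)ᶜ) := fun e => by
        have := MeasurableSpace.measurableSet_generateFrom (s := {A e}) (Set.mem_singleton (A e))
        split_ifs
        · exact this
        · exact this.compl
      rw [measureReal_def, hind.meas_iInter hgen, ENNReal.toReal_prod]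
      refine Finset.prod_congr rfl fun e _ => ?_
      have he : μ.real (A e) = (pairProb p ∘ φ) e := by
        rw [Function.comp_apply, pairProb_mk p e.2]
        exact hG.prob_adj _ _ e.2
      split_ifs
      · exact he
      · rw [← he]
        exact probReal_compl_eq_one_sub (hAm e)
  let D : Set ({e : Fin n × Fin n // e.1 < e.2} → Bool) :=
    {c | ∀ x : Sym2 (Fin n) → Bool, x ∘ φ = c → ∃ v : Fin n → ℝ, v ≠ 0 ∧ edgeMatrix x *ᵥ v = 0}
  have hsub : {ω | (realAdjMatrix (G ω)).rank < n} ⊆ ⋃ c ∈ Finset.univ.filter (· ∈ D), Y c := by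
    intro ω hω
    simp only [Set.mem_iUnion]
    refine ⟨fun e => decide ((G ω).Adj e.1.1 e.1.2), ?_, ?_⟩
    · refine Finset.mem_filter.2 ⟨Finset.mem_univ _, fun x hx => ?_⟩
      rw [← realAdjMatrix_eq_edgeMatrix (G ω) x fun i j hij => ?_]
      · exact exists_null_of_rank_lt hω
      · have := congrFun hx ⟨(i, j), hij⟩
        simp only [Function.comp_apply, φ] at this
        simp [this]
    · refine Set.mem_iInter.2 fun e => ?_
      by_cases he : (G ω).Adj e.1.1 e.1.2 <;> simp [he, A]
  calc μ.real {ω | (realAdjMatrix (G ω)).rank < n}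
      ≤ ∑ c ∈ Finset.univ.filter (· ∈ D), μ.real (Y c) :=
        (measureReal_mono hsub (measure_ne_top _ _)).trans (measureReal_biUnion_finset_le _ _)
    _ = prodPr (pairProb p ∘ φ) D := by
        rw [prodPr, prodExp, Finset.sum_filter]
        refine Finset.sum_congr rfl fun c _ => ?_
        by_cases hc : c ∈ D <;> simp [hc, hY]
    _ = prodExp (pairProb p) (fun _ => prodPr (pairProb p ∘ φ) D) := (prodExp_const _ _).symm
    _ = prodExp (pairProb p) (fun x => prodPr (pairProb p ∘ φ) {y | Function.extend φ y x ∈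
          {x | ∃ v : Fin n → ℝ, v ≠ 0 ∧ edgeMatrix x *ᵥ v = 0}}) := by
        congr 1
        funext x
        congr 1
        ext y
        refine ⟨fun hy => hy _ (funext fun e => hφ.extend_apply _ _ _), fun hy x' hx' => ?_⟩
        have : edgeMatrix x' = edgeMatrix (Function.extend φ y x) := by
          let H : SimpleGraph (Fin n) := SimpleGraph.fromRel fun i j => x' s(i, j)
          have hH : ∀ i j : Fin n, i < j → (H.Adj i j ↔ x' s(i, j)) := fun i j hij => by
            simp [H, hij.ne, Sym2.eq_swap (a := j)]
          rw [← realAdjMatrix_eq_edgeMatrix H x' hH, ← realAdjMatrix_eq_edgeMatrix H _ ?_]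
          intro i j hij
          have h1 := congrFun hx' ⟨(i, j), hij⟩
          have h2 := hφ.extend_apply y x ⟨(i, j), hij⟩
          simp only [Function.comp_apply, φ] at h1 h2
          rw [hH i j hij, h1]
          exact iff_of_eq (congrArg (· = true) h2.symm)
        rw [this]
        exact hy
    _ = _ := prodPr_extend _ hφ _

/-- Independent edges with prescribed probabilities exist: take the product of Bernoulli
measures. -/
lemma exists_isIndepEdgeRandomGraph {n : ℕ} (p : Fin n → Fin n → ℝ)
    (h0 : ∀ i j, i < j → 0 ≤ p i j) (h1 : ∀ i j, i < j → p i j ≤ 1) :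
    ∃ (Ω : Type) (_ : MeasurableSpace Ω) (μ : Measure Ω) (_ : IsProbabilityMeasure μ)
      (G : Ω → SimpleGraph (Fin n)), IsIndepEdgeRandomGraph p μ G := by
  let E := {e : Fin n × Fin n // e.1 < e.2}
  let ν : E → Measure Bool := fun e =>
    bernoulliMeasure true false ⟨p e.1.1 e.1.2, h0 _ _ e.2, h1 _ _ e.2⟩
  let G : (E → Bool) → SimpleGraph (Fin n) := fun c =>
    { Adj := fun i j => (∃ h : i < j, c ⟨(i, j), h⟩) ∨ ∃ h : j < i, c ⟨(j, i), h⟩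
      symm := ⟨fun _ _ => Or.symm⟩
      loopless := ⟨fun i h => by rcases h with ⟨h, -⟩ | ⟨h, -⟩ <;> exact lt_irrefl i h⟩ }
  have hG : ∀ e : E, {c | (G c).Adj e.1.1 e.1.2} = (fun c : E → Bool => c e) ⁻¹' {true} :=
      fun e => by
    ext c
    simp [G, e.2, e.2.asymm]
  have hm : ∀ e : E, MeasurableSet {c | (G c).Adj e.1.1 e.1.2} := fun e => by
    rw [hG]
    exact measurable_pi_apply e (measurableSet_singleton true)
  refine ⟨E → Bool, inferInstance, Measure.pi ν, inferInstance, G,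
    fun i j hij => hm ⟨(i, j), hij⟩, fun i j hij => ?_, ?_⟩
  · have := hG ⟨(i, j), hij⟩
    simp only at this
    rw [this, measureReal_def, (measurePreserving_eval ν ⟨(i, j), hij⟩).measure_preimage
      (measurableSet_singleton true).nullMeasurableSet, ← measureReal_def]
    simp [ν]
  · rw [iIndepSet_iff_meas_biInter hm]
    intro s
    have hind := iIndepFun_pi (μ := ν) (X := fun _ => id) fun _ => aemeasurable_id
    simp only [hG]
    exact hind.measure_inter_preimage_eq_mul s (sets := fun _ => {true})
      fun _ _ => measurableSet_singleton true

end Transfer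

/-! ### The rate -/

section Asymptotics

open Filter Matrix

lemma exp_neg_le_one_sub_min {x : ℝ} (hx : 0 ≤ x) : Real.exp (-x) ≤ 1 - min 1 x / 2 := by
  have h1 : Real.exp (-x) ≤ 1 / (1 + x) := by
    rw [Real.exp_neg, ← one_div]
    exact one_div_le_one_div_of_le (by linarith) (by linarith [Real.add_one_le_exp x])
  refine h1.trans ?_
  rw [div_le_iff₀ (by linarith)]
  rcases le_total x 1 with h | h
  · rw [min_eq_right h]; nlinarith
  · rw [min_eq_left h]; linarith

lemma walkBound_one_le_exp {q : ℝ} (h0 : 0 ≤ q) (h1 : q ≤ 1 / 2) (k : ℕ) :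
    walkBound q k 1 ≤ Real.exp (-(min 1 (2 * q * k) / 4)) := by
  have hpow : (1 - 2 * q) ^ k ≤ Real.exp (-(2 * q * k)) := by
    rw [show -(2 * q * k) = k * (-(2 * q)) by ring, Real.exp_nat_mul]
    exact pow_le_pow_left₀ (by linarith) (by linarith [Real.add_one_le_exp (-(2 * q))]) k
  have hmin := exp_neg_le_one_sub_min (show 0 ≤ 2 * q * k by positivity)
  have := Real.add_one_le_exp (-(min 1 (2 * q * k) / 4))
  linarith [walkBound_one_le_half h0 h1 k]

/-- A single term of the union bound for sparse near-null vectors. While `q k` is small, each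
remaining row is orthogonal to the vector with probability about `1 - q k`, and `q n` beats
`log n`; after that, it is so with probability bounded away from `1`, and `n` beats `k log n`. -/
lemma sparse_term_le {q : ℝ} {n k h : ℕ} (h0 : 0 ≤ q) (h1 : q ≤ 1 / 2) (hk : 1 ≤ k)
    (hkh : k < 4 * h) (hn : 1 ≤ Real.log n) (hq : 24 * Real.log n ≤ q * n)
    (hh : (16 * h + 2) * Real.log n ≤ n / 8) :
    (n : ℝ) ^ (2 * k + 2) * walkBound q k 1 ^ (n - (2 * k + 2)) ≤ Real.exp (-(2 * Real.log n)) := by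
  have hn0 : (0 : ℝ) < n := by
    rcases Nat.eq_zero_or_pos n with rfl | h
    · norm_num at hn
    · exact_mod_cast h
  have hk' : (1 : ℝ) ≤ k := by exact_mod_cast hk
  have hkh' : (k : ℝ) + 1 ≤ 4 * h := by exact_mod_cast hkh
  have hbig : 16 * (h : ℝ) + 2 ≤ n / 8 := le_trans (le_mul_of_one_le_right (by positivity) hn) hh
  have hexp : (n : ℝ) / 2 ≤ ((n - (2 * k + 2) : ℕ) : ℝ) := by
    have h2 : 2 * k + 2 ≤ n := by
      have : (2 * k + 2 : ℝ) ≤ n := by linarith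
      exact_mod_cast this
    rw [Nat.cast_sub h2]
    push_cast
    linarith
  set m := min 1 (2 * q * k) with hm
  have hm0 : 0 ≤ m := le_min zero_le_one (by positivity)
  have e1 : walkBound q k 1 ^ (n - (2 * k + 2)) ≤ Real.exp (-(m * n / 8)) := by
    refine (pow_le_pow_left₀ (walkBound_nonneg h0 h1 _ _) (walkBound_one_le_exp h0 h1 k) _).trans ?_
    rw [← Real.exp_nat_mul]
    refine Real.exp_le_exp.2 ?_
    nlinarith
  have e2 : (n : ℝ) ^ (2 * k + 2) = Real.exp ((2 * k + 2) * Real.log n) := by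
    rw [show (2 * (k : ℝ) + 2) = ((2 * k + 2 : ℕ) : ℝ) by push_cast; ring, Real.exp_nat_mul,
      Real.exp_log hn0]
  rw [e2]
  refine (mul_le_mul_of_nonneg_left e1 (Real.exp_nonneg _)).trans ?_
  rw [← Real.exp_add]
  refine Real.exp_le_exp.2 ?_
  rcases min_choice 1 (2 * q * k) with h | h
  · rw [hm, h]
    nlinarith
  · rw [hm, h]
    have h3 := mul_le_mul_of_nonneg_left hq (show (0 : ℝ) ≤ k by positivity)
    have h4 := mul_le_mul_of_nonneg_right hk' (show 0 ≤ Real.log n by linarith)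
    nlinarith

/-- With `n ^ κ ≤ h` and `n ^ (-β) ≤ q`, where `κ = 1 - ε / 5`, the loss `n / h` of the averaging
and the bound `(q h)^(-1/4)` of the quadratic estimate multiply up to the claimed rate. -/
lemma averaged_term_le {ε β q : ℝ} {n h : ℕ} (hn : 1 ≤ n) (hq : (n : ℝ) ^ (-β) ≤ q)
    (h1 : q ≤ 1 / 2) (hh : (n : ℝ) ^ (1 - ε / 5) ≤ h) :
    1 / (4 * h) * (n * √(3 * walkBound q h 1)) ≤ 3 * (n : ℝ) ^ (-(1 - ε - β) / 4) := by
  have hn0 : (0 : ℝ) < n := by exact_mod_cast hn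
  have hq0 : 0 < q := lt_of_lt_of_le (Real.rpow_pos_of_pos hn0 _) hq
  have hh0 : (0 : ℝ) < h := lt_of_lt_of_le (Real.rpow_pos_of_pos hn0 _) hh
  set δ := (1 - ε / 5 - β) / 4 with hδ
  have hqh : (n : ℝ) ^ (4 * δ) ≤ q * h := by
    calc (n : ℝ) ^ (4 * δ) = (n : ℝ) ^ (-β) * (n : ℝ) ^ (1 - ε / 5) := by
          rw [← Real.rpow_add hn0]; congr 1; rw [hδ]; ring
      _ ≤ q * h := mul_le_mul hq hh (by positivity) hq0.le
  have hsqrt : (n : ℝ) ^ (2 * δ) ≤ √(q * h) := by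
    refine Real.le_sqrt_of_sq_le ?_
    rw [← Real.rpow_natCast, ← Real.rpow_mul hn0.le]
    convert! hqh using 2
    push_cast
    ring
  have hw : 3 * walkBound q h 1 ≤ (3 * (n : ℝ) ^ (-δ)) ^ 2 := by
    have e : ((n : ℝ) ^ (-δ)) ^ 2 = 1 / (n : ℝ) ^ (2 * δ) := by
      rw [one_div, ← Real.rpow_neg hn0.le, ← Real.rpow_natCast, ← Real.rpow_mul hn0.le]
      congr 1; push_cast; ring
    have h2 := walkBound_one_le hq0 h1 (show 0 < h by exact_mod_cast hh0)
    have h3 : 2 / √(q * h) ≤ 2 * (1 / (n : ℝ) ^ (2 * δ)) := by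
      rw [mul_one_div]
      exact div_le_div_of_nonneg_left (by norm_num) (by positivity) hsqrt
    have h4 : 0 ≤ 1 / (n : ℝ) ^ (2 * δ) := by positivity
    rw [mul_pow, e]
    linarith
  have hs : √(3 * walkBound q h 1) ≤ 3 * (n : ℝ) ^ (-δ) := Real.sqrt_le_iff.2 ⟨by positivity, hw⟩
  have hinv : 1 / (4 * (h : ℝ)) ≤ (n : ℝ) ^ (-(1 - ε / 5)) := by
    rw [Real.rpow_neg hn0.le, ← one_div]
    exact one_div_le_one_div_of_le (by positivity) (by linarith)
  calc 1 / (4 * h) * (n * √(3 * walkBound q h 1))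
      ≤ (n : ℝ) ^ (-(1 - ε / 5)) * (n * (3 * (n : ℝ) ^ (-δ))) := by gcongr
    _ = 3 * ((n : ℝ) ^ (-(1 - ε / 5)) * (n : ℝ) ^ (1 : ℝ) * (n : ℝ) ^ (-δ)) := by
        rw [Real.rpow_one]; ring
    _ = 3 * (n : ℝ) ^ (-(1 - ε - β) / 4) := by
        rw [← Real.rpow_add hn0, ← Real.rpow_add hn0]
        congr 2
        rw [hδ]; ring

lemma eventually_parameters (ε β c : ℝ) (hε : 0 < ε) (hε1 : ε < 1) (hβ1 : β < 1) (hc : 0 < c) :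
    ∀ᶠ n : ℕ in atTop, 2 ≤ n ∧ 1 ≤ Real.log n ∧ 1 ≤ c * Real.log n ∧
      24 ≤ c * (n : ℝ) ^ (1 - β) ∧
      (16 * (⌈(n : ℝ) ^ (1 - ε / 5)⌉₊ : ℝ) + 2) * Real.log n ≤ n / 8 := by
  have hlog : Tendsto (fun n : ℕ => Real.log n) atTop atTop :=
    Real.tendsto_log_atTop.comp tendsto_natCast_atTop_atTop
  have hpow : Tendsto (fun n : ℕ => (n : ℝ) ^ (1 - β)) atTop atTop :=
    (tendsto_rpow_atTop (by linarith)).comp tendsto_natCast_atTop_atTop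
  -- `272 = 8 * 34`, and `16 * ⌈n ^ (1 - ε / 5)⌉₊ + 2 ≤ 34 * n ^ (1 - ε / 5)`
  have hlittle := tendsto_natCast_atTop_atTop.eventually
    ((isLittleO_log_rpow_atTop (show 0 < ε / 5 by linarith)).bound
      (show (0 : ℝ) < 1 / 272 by norm_num))
  filter_upwards [eventually_ge_atTop 2, hlog.eventually_ge_atTop 1,
    (hlog.const_mul_atTop hc).eventually_ge_atTop 1,
    (hpow.const_mul_atTop hc).eventually_ge_atTop 24, hlittle] with n h2 hl1 hl2 hp hlit
  refine ⟨h2, hl1, hl2, hp, ?_⟩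
  have hn1 : (1 : ℝ) ≤ n := by exact_mod_cast (by omega : 1 ≤ n)
  have hn0 : (0 : ℝ) < n := by linarith
  have hκ : 1 ≤ (n : ℝ) ^ (1 - ε / 5) := Real.one_le_rpow hn1 (by linarith)
  have hceil := (Nat.ceil_lt_add_one (show 0 ≤ (n : ℝ) ^ (1 - ε / 5) by positivity)).le
  rw [Real.norm_of_nonneg (by linarith), Real.norm_of_nonneg (by positivity)] at hlit
  calc (16 * (⌈(n : ℝ) ^ (1 - ε / 5)⌉₊ : ℝ) + 2) * Real.log n
      ≤ (34 * (n : ℝ) ^ (1 - ε / 5)) * (1 / 272 * (n : ℝ) ^ (ε / 5)) :=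
        mul_le_mul (by linarith) hlit (by linarith) (by positivity)
    _ = ((n : ℝ) ^ (1 - ε / 5) * (n : ℝ) ^ (ε / 5)) / 8 := by ring
    _ = n / 8 := by rw [← Real.rpow_add hn0, sub_add_cancel, Real.rpow_one]

/-- The rate for all large `n`, for independent entries above the diagonal. -/
lemma eventually_prodPr_singular_le (ε β c : ℝ) (hε : 0 < ε) (hβ : 0 < β) (hεβ : ε + β < 1)
    (hc : 0 < c) :
    ∀ᶠ n : ℕ in atTop, ∀ p : Sym2 (Fin n) → ℝ, c * Real.log n / (n : ℝ) ^ β ≤ 1 / 2 →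
      (∀ e, c * Real.log n / (n : ℝ) ^ β ≤ p e) → (∀ e, p e ≤ 1 - c * Real.log n / (n : ℝ) ^ β) →
      prodPr p {x | ∃ v : Fin n → ℝ, v ≠ 0 ∧ edgeMatrix x *ᵥ v = 0} ≤
        4 * (n : ℝ) ^ (-(1 - ε - β) / 4) := by
  filter_upwards [eventually_parameters ε β c hε (by linarith) (by linarith) hc] with n hn p
  obtain ⟨h2, hl1, hcl, hpow, hh⟩ := hn
  set q := c * Real.log n / (n : ℝ) ^ β with hq
  set h := ⌈(n : ℝ) ^ (1 - ε / 5)⌉₊ with hhdef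
  intro h1 hp hp'
  have hn0 : (0 : ℝ) < n := by exact_mod_cast (by omega : 0 < n)
  have hn1 : (1 : ℝ) ≤ n := by exact_mod_cast (by omega : 1 ≤ n)
  have hq1 : (n : ℝ) ^ (-β) ≤ q := by
    rw [hq, Real.rpow_neg hn0.le, ← one_div]
    gcongr
  have hq0 : 0 ≤ q := le_trans (by positivity) hq1
  have hqn : 24 * Real.log n ≤ q * n := by
    have : q * n = c * (n : ℝ) ^ (1 - β) * Real.log n := by
      rw [hq, Real.rpow_sub hn0, Real.rpow_one]; ring
    rw [this]
    exact mul_le_mul_of_nonneg_right hpow (by linarith)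
  have hh0 : 0 < h := Nat.ceil_pos.2 (by positivity)
  have hbig : 128 * h + 16 ≤ n := by
    have : 16 * (h : ℝ) + 2 ≤ n / 8 := le_trans (le_mul_of_one_le_right (by positivity) hl1) hh
    have : 128 * (h : ℝ) + 16 ≤ n := by linarith
    exact_mod_cast this
  have hmain := prodPr_singular_le hq0 h1 hp hp' hh0 (by rw [Fintype.card_fin]; omega)
  have hsparse := prodPr_sparseNearNull_le hq0 h1 hp hp' (K := 4 * h)
    (by rw [Fintype.card_fin]; omega)
  rw [Fintype.card_fin] at hmain hsparse
  have hterm := Finset.sum_le_card_nsmul (Finset.Ico 1 (4 * h)) _ _ fun k hk =>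
    sparse_term_le hq0 h1 (Finset.mem_Ico.1 hk).1 (Finset.mem_Ico.1 hk).2 hl1 hqn hh
  have hexp : Real.exp (-(2 * Real.log n)) = 1 / (n : ℝ) ^ 2 := by
    rw [Real.exp_neg, one_div, two_mul, Real.exp_add, Real.exp_log hn0, sq]
  rw [Nat.card_Ico, nsmul_eq_mul, hexp] at hterm
  have hrate : ((4 * h - 1 : ℕ) : ℝ) * (1 / (n : ℝ) ^ 2) ≤ (n : ℝ) ^ (-(1 - ε - β) / 4) := by
    have e1 : ((4 * h - 1 : ℕ) : ℝ) ≤ n := by exact_mod_cast (by omega : 4 * h - 1 ≤ n)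
    calc ((4 * h - 1 : ℕ) : ℝ) * (1 / (n : ℝ) ^ 2) ≤ n * (1 / (n : ℝ) ^ 2) := by gcongr
      _ = (n : ℝ) ^ (-1 : ℝ) := by rw [Real.rpow_neg_one]; field_simp
      _ ≤ _ := Real.rpow_le_rpow_of_exponent_le hn1 (by linarith)
  have hav := averaged_term_le (ε := ε) (by omega) hq1 h1 (Nat.le_ceil _)
  rw [← hhdef] at hav
  linarith

end Asymptotics

theorem mainTheorem2 (ε β c : ℝ) (hε : 0 < ε) (hβ : 0 < β) (hεβ : ε + β < 1) (hc : 0 < c) :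
    ∃ C : ℝ, 0 < C ∧ ∀ (n : ℕ), 1 ≤ n → ∀ (p : Fin n → Fin n → ℝ),
      (∀ i j : Fin n, i < j →
        c * Real.log n / (n : ℝ) ^ β ≤ p i j ∧ p i j ≤ 1 - c * Real.log n / (n : ℝ) ^ β) →
      (∃ (Ω : Type) (_ : MeasurableSpace Ω) (μ : Measure Ω) (_ : IsProbabilityMeasure μ)
        (G : Ω → SimpleGraph (Fin n)), IsIndepEdgeRandomGraph p μ G) ∧
      (∀ (Ω : Type*) [MeasurableSpace Ω] (μ : Measure Ω) [IsProbabilityMeasure μ]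
        (G : Ω → SimpleGraph (Fin n)), IsIndepEdgeRandomGraph p μ G →
        μ.real {ω | (realAdjMatrix (G ω)).rank < n} ≤ C * (n : ℝ) ^ (-(1 - ε - β) / 4)) := by
  obtain ⟨N, hN⟩ := Filter.eventually_atTop.1 (eventually_prodPr_singular_le ε β c hε hβ hεβ hc)
  refine ⟨max 4 ((N : ℝ) + 2), by positivity, fun n hn p hp => ?_⟩
  have hn1 : (1 : ℝ) ≤ n := by exact_mod_cast hn
  have hq0 : 0 ≤ c * Real.log n / (n : ℝ) ^ β :=
    div_nonneg (mul_nonneg hc.le (Real.log_nonneg hn1)) (by positivity)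
  refine ⟨exists_isIndepEdgeRandomGraph p (fun i j hij => hq0.trans (hp i j hij).1)
    fun i j hij => (hp i j hij).2.trans (by linarith), fun Ω _ μ _ G hG => ?_⟩
  have hr : 0 ≤ (n : ℝ) ^ (-(1 - ε - β) / 4) := by positivity
  by_cases hnN : N + 2 ≤ n
  · have hq1 : c * Real.log n / (n : ℝ) ^ β ≤ 1 / 2 := by
      have := hp ⟨0, by omega⟩ ⟨1, by omega⟩ (Fin.mk_lt_mk.2 zero_lt_one)
      linarith [this.1, this.2]
    have hpair : ∀ e, c * Real.log n / (n : ℝ) ^ β ≤ pairProb p e ∧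
        pairProb p e ≤ 1 - c * Real.log n / (n : ℝ) ^ β := fun e => by
      rw [pairProb]
      split_ifs with he
      · exact hp _ _ he
      · constructor <;> linarith
    refine hG.measureReal_le.trans ((hN n (by omega) (pairProb p) hq1 (fun e => (hpair e).1)
      fun e => (hpair e).2).trans ?_)
    exact mul_le_mul_of_nonneg_right (le_max_left _ _) hr
  · -- for the finitely many small `n` the bound is at least `1`
    have hnN' : (n : ℝ) ≤ N + 2 := by exact_mod_cast (by omega : n ≤ N + 2)
    calc μ.real {ω | (realAdjMatrix (G ω)).rank < n} ≤ 1 := measureReal_le_one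
      _ = n * (n : ℝ) ^ (-1 : ℝ) := by rw [Real.rpow_neg_one]; field_simp
      _ ≤ max 4 ((N : ℝ) + 2) * (n : ℝ) ^ (-(1 - ε - β) / 4) :=
          mul_le_mul (hnN'.trans (le_max_right _ _))
            (Real.rpow_le_rpow_of_exponent_le hn1 (by linarith)) (by positivity) (by positivity)
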